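/- Let $k$ be a field. For a quiver $Q$ with finite vertex set $Q_0$ and $I\subseteq Q_0$, let $Q|_I$ be the full subquiver on $I$; representations are finite dimensional over $k$, and $\underline{\dim}\,M\in\mathbb{R}^{Q_0}$ is the dimension vector of $M$. A *tilting module* over $Q$ is a direct sum $T=\bigoplus_i T(i)$ of $|Q_0|$ pairwise non-isomorphic indecomposable representations with $\mathrm{Ext}^1(T,T)=0$. A *support tilting module* is a direct sum of indecomposables that is a tilting module when restricted to the full subquiver on its support. A *2-support tilting module* is a module $T=T^+\oplus T^-$ with $T^+,T^-$ support tilting modules such that $Q_0$ is the disjoint union of their supports. Let - $P^+(Q)$ be the union of the simplices $\mathrm{conv}\{0,\underline{\dim}\,T(i)\}$ over all tilting modules $T$, - $P^{\mathrm{clus}}(Q)$ be the union of the simplices $\mathrm{conv}\{0,\underline{\dim}\,T(i),-e_j \mid j\notin\mathrm{supp}\,T\}$ over all support tilting modules $T$, - $P(Q)$ be the union of the simplices $\mathrm{conv}\{0,\underline{\dim}\,T^+(i),-\underline{\dim}\,T^-(j)\}$ over all 2-support tilting modules $T=T^+\oplus T^-$, and let $t^+(Q)$, $t^{\mathrm{clus}}(Q)$,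 $t(Q)$ be the volumes of $P^+(Q)$, $P^{\mathrm{clus}}(Q)$, $P(Q)$, where the volume on $\mathbb{R}^{Q_0}$ is $|Q_0|!$ times the Lebesgue measure. For every $m\ge 0$ let $\mathbb{A}_m$ denote a quiver of type $\mathbb{A}$ with $m$ vertices, with an arbitrary orientation chosen independently for each $m$. Then for every $n\ge 1$, with $Q_0$ the vertex set of $\mathbb{A}_n$, $$t(\mathbb{A}_n)=\sum_{I\subseteq Q_0}t^+(\mathbb{A}_n|_I)\,t^+(\mathbb{A}_n|_{Q_0\setminus I}),$$ $$t^{\mathrm{clus}}(\mathbb{A}_n)=\sum_{I\subseteq Q_0}t^+(\mathbb{A}_n|_{Q_0\setminus I})=\sum_{i=0}^{n}t^+(\mathbb{A}_i)\,t^+(\mathbb{A}_{n-i}),$$ $$t^+(\mathbb{A}_n)=\sum_{i\in Q_0}t^+(\mathbb{A}_n|_{Q_0\setminus\{i\}})=\sum_{i=0}^{n-1}t^+(\mathbb{A}_i)\,t^+(\mathbb{A}_{n-1-i}).$$ -/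

import Mathlib

open MeasureTheory

open scoped ENNReal

noncomputable section

universe u v w

/-- The full subquiver `Q|_S` of a quiver `Q` on a set `S` of vertices. -/
@[reducible] def fullSubquiver {V : Type v} (Q : Quiver.{w} V) (S : Set V) : Quiver.{w} S where
  Hom x y := @Quiver.Hom V Q x y

/-- The quiver of type `A_n` on the vertices `0, …, n - 1` in which the edge between `i` and `i + 1`
is oriented by `o i`: it is an arrow `i → i + 1` if `o i = true`, and an arrow `i + 1 → i` if
`o i = false`. Only the values `o i` with `i + 1 < n` matter. -/
@[reducible] def typeA (n : ℕ) (o : ℕ → Bool) : Quiver.{0} (Fin n) where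
  Hom i j := PLift (((i : ℕ) + 1 = j ∧ o i = true) ∨ ((j : ℕ) + 1 = i ∧ o j = false))

/-- A finite dimensional representation of the quiver `Q` over the field `k`. -/
structure QuiverRep (k : Type u) [Field k] {V : Type v} (Q : Quiver.{w} V) where
  space : V → Type u
  [addCommGroup : ∀ x, AddCommGroup (space x)]
  [module : ∀ x, Module k (space x)]
  [finiteDimensional : ∀ x, FiniteDimensional k (space x)]
  map : ∀ {x y : V}, @Quiver.Hom V Q x y → (space x →ₗ[k] space y)

attribute [instance] QuiverRep.addCommGroup QuiverRep.module QuiverRep.finiteDimensional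

namespace QuiverRep

variable {k : Type u} [Field k] {V : Type v} {Q : Quiver.{w} V}

/-- Two representations are isomorphic. -/
def Isomorphic (M N : QuiverRep k Q) : Prop :=
  ∃ e : ∀ x, M.space x ≃ₗ[k] N.space x,
    ∀ (x y : V) (a : @Quiver.Hom V Q x y) (m : M.space x), e y (M.map a m) = N.map a (e x m)

/-- The zero representation. -/
def IsZero (M : QuiverRep k Q) : Prop := ∀ x, Subsingleton (M.space x)

/-- The direct sum of two representations. -/
def prod (M N : QuiverRep k Q) : QuiverRep k Q where
  space x := M.space x × N.space x
  map a := (M.map a).prodMap (N.map a)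

/-- The direct sum of a finite family of representations. -/
def directSum {ι : Type} [Finite ι] (T : ι → QuiverRep k Q) : QuiverRep k Q where
  space x := ∀ i, (T i).space x
  map a := LinearMap.pi fun i => (T i).map a ∘ₗ LinearMap.proj i

/-- `M` is nonzero and has no decomposition into a direct sum of two nonzero representations. -/
def Indecomposable (M : QuiverRep k Q) : Prop :=
  ¬ M.IsZero ∧ ∀ A B : QuiverRep k Q, M.Isomorphic (A.prod B) → A.IsZero ∨ B.IsZero

/-- The restriction of a representation to a full subquiver. -/
def restrict (M : QuiverRep k Q) (S : Set V) : QuiverRep k (fullSubquiver Q S) where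
  space x := M.space x
  map {x y} a := M.map (x := (x : V)) (y := (y : V)) a

/-- The dimension vector, as a point of `ℝ^V`. -/
def dimVec (M : QuiverRep k Q) : V → ℝ := fun x => (Module.finrank k (M.space x) : ℝ)

/-- The map `Hom(P⁰, W) → Hom(P¹, W)` induced by the standard projective resolution
`0 → P¹ → P⁰ → M → 0`, where `P⁰ = ⨁_x P(x) ⊗ M_x` and `P¹ = ⨁_{a : x → y} P(y) ⊗ M_x`, under the
identifications `Hom(P⁰, W) = ∏_x Hom(M_x, W_x)` and `Hom(P¹, W) = ∏_{a : x → y} Hom(M_x, W_y)`. -/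
def extMap (M W : QuiverRep k Q) :
    (∀ x, M.space x →ₗ[k] W.space x) →ₗ[k]
      (∀ (x y : V), @Quiver.Hom V Q x y → (M.space x →ₗ[k] W.space y)) where
  toFun f := fun x y a => W.map a ∘ₗ f x - f y ∘ₗ M.map a
  map_add' f g := by
    funext x y a
    ext m
    simp only [Pi.add_apply, LinearMap.sub_apply, LinearMap.comp_apply, LinearMap.add_apply,
      map_add]
    abel
  map_smul' c f := by
    funext x y a
    ext m
    simp [smul_sub]

/-- `Ext¹(M, W)`, the cokernel of `Hom(P⁰, W) → Hom(P¹, W)`. -/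
abbrev Ext1 (M W : QuiverRep k Q) : Type _ :=
  (∀ (x y : V), @Quiver.Hom V Q x y → (M.space x →ₗ[k] W.space y)) ⧸ LinearMap.range (extMap M W)

/-- The family `T` consists of the indecomposable direct summands of a (basic) tilting module:
`⨁ T i` is a direct sum of `n` pairwise non-isomorphic indecomposable representations without self
extensions, where `n` is the number of vertices. -/
structure IsTilting {m : ℕ} (T : Fin m → QuiverRep k Q) : Prop where
  card_eq : m = Nat.card V
  indecomposable : ∀ i, (T i).Indecomposable
  pairwise_not_isomorphic : ∀ i j, i ≠ j → ¬ (T i).Isomorphic (T j)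
  rigid : Subsingleton (Ext1 (directSum T) (directSum T))

/-- The support of the module `⨁ T i`: the union of the supports of the `T i`. -/
def supp {m : ℕ} (T : Fin m → QuiverRep k Q) : Set V :=
  {x | ∃ i, Nontrivial ((T i).space x)}

/-- `⨁ T i` is a tilting module if restricted to its support. -/
def IsSupportTilting {m : ℕ} (T : Fin m → QuiverRep k Q) : Prop :=
  IsTilting fun i => (T i).restrict (supp T)

end QuiverRep

section Polytopes

open QuiverRep

variable (k : Type u) [Field k] {V : Type v} (Q : Quiver.{w} V)

/-- `P⁺(Q)`: the union of the simplices `σ_T = conv {dim T i, 0}` over all tilting modules `T`. -/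
def PPlus : Set (V → ℝ) :=
  {p | ∃ (m : ℕ) (T : Fin m → QuiverRep k Q), IsTilting T ∧
    p ∈ convexHull ℝ (insert 0 (Set.range fun i => (T i).dimVec))}

/-- `P^clus(Q)`: the union of the simplices `σ_T = conv {dim T i, -e_j, 0}` over all support tilting
modules `T`, where `j` runs over the vertices outside the support of `T`. -/
def PClus [DecidableEq V] : Set (V → ℝ) :=
  {p | ∃ (m : ℕ) (T : Fin m → QuiverRep k Q), IsSupportTilting T ∧
    p ∈ convexHull ℝ (insert 0
      ((Set.range fun i => (T i).dimVec) ∪ (fun j => -Pi.single j (1 : ℝ)) '' (supp T)ᶜ))}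

/-- `P(Q)`: the union of the simplices `σ_T = conv {dim T⁺ i, -dim T⁻ j, 0}` over all 2-support
tilting modules `T = T⁺ ⊕ T⁻`, that is, `T⁺` and `T⁻` are support tilting modules and the set of
vertices is the disjoint union of their supports. -/
def PFull : Set (V → ℝ) :=
  {p | ∃ (m l : ℕ) (Tp : Fin m → QuiverRep k Q) (Tm : Fin l → QuiverRep k Q),
    IsSupportTilting Tp ∧ IsSupportTilting Tm ∧ IsCompl (supp Tp) (supp Tm) ∧
    p ∈ convexHull ℝ (insert 0
      ((Set.range fun i => (Tp i).dimVec) ∪ Set.range fun j => -(Tm j).dimVec))}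

variable [Fintype V]

/-- The integral volume on `ℝ^V`: `n!` times the Lebesgue measure, where `n` is the number of
elements of `V`. -/
def integralVolume (S : Set (V → ℝ)) : ℝ≥0∞ :=
  (Nat.factorial (Fintype.card V) : ℝ≥0∞) * volume S

/-- `t⁺(Q) = vol P⁺(Q)`. -/
def tPlus : ℝ≥0∞ := integralVolume (PPlus k Q)

/-- `t^clus(Q) = vol P^clus(Q)`. -/
def tClus [DecidableEq V] : ℝ≥0∞ := integralVolume (PClus k Q)

/-- `t(Q) = vol P(Q)`. -/
def tFull : ℝ≥0∞ := integralVolume (PFull k Q)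

end Polytopes

end

/-! Everything rests on one piecewise linear function. For a nonnegative vector `d`, `seqGauge` adds
up the drops `d i - min (d i) (d (i + 1))` along the line, where missing positions count as zero. It
does not see the orientation of the arrows.

First, the polytopes are sublevel sets of this gauge (`PPlus_eq`, `PFull_eq`, `PClus_eq`). If `T` is
rigid, then along each arrow either every summand has an injective map or every summand has a
surjective one. So the dimensions of all summands move in the same direction, minima are additive,
and the gauge is linear on the cone of `T`. Indecomposables are intervals, which have gauge one, so
the gauge is the sum of the coefficients (`IsTilting.seqGauge_eq`). Conversely, a sweep along the
line decomposes every nonnegative vector into the dimension vectors of a tilting module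
(`exists_isPartialTilting`, `isTilting_intervalRep`). Hence `P⁺` consists of the nonnegative vectors
of gauge at most one. For `P` and `P^clus` the gauge of the positive part is increased by the gauge,
respectively the coordinate sum, of the negative part.

Second, `n!` times the volume of the sublevel set of a homogeneous function `h` is the integral of
`exp (-h)` (`factorial_mul_volume_eq_lintegral`). The exponential turns sums into products, so
cutting `ℝ^n` into orthants gives the formulas over subsets `I` (`lintegral_sup_zero_mul`). The
exponential of minus the coordinate sum has integral one over an orthant, which explains the missing
second factor for `t^clus`.

Third, adding a constant `m ≥ 0` to all coordinates raises the gauge by `m`. Subtracting the least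
coordinate and integrating it out therefore leaves the integrals over the faces on which one
coordinate vanishes; this is the formula for `t⁺` over the vertices
(`lintegral_Ici_eq_sum_insertNth`). A vanishing coordinate cuts the line into two independent pieces
(`transfer_append_false`), which gives the Catalan recursion. Sorting subsets by their first missing
vertex gives the same recursion, shifted by one, for the sum over all `I`
(`sum_transfer_ofFn_zero`), and hence the product formula for `t^clus`. -/

noncomputable section

universe u v w

/-! ### Linear quivers, possibly with gaps -/

/-- A quiver whose vertices are placed injectively at positions in `ℕ`, with exactly one arrow
between vertices at neighbouring positions, oriented by `o`, and no other arrows. -/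
structure IsLinear {V : Type v} (Q : Quiver.{w} V) (o : ℕ → Bool) (pos : V → ℕ) : Prop where
  injective : Function.Injective pos
  subsingleton : ∀ x y, Subsingleton (@Quiver.Hom V Q x y)
  nonempty_iff : ∀ x y, Nonempty (@Quiver.Hom V Q x y) ↔
    (pos x + 1 = pos y ∧ o (pos x) = true) ∨ (pos y + 1 = pos x ∧ o (pos y) = false)

theorem isLinear_typeA (n : ℕ) (o : ℕ → Bool) : IsLinear (typeA n o) o (fun i => (i : ℕ)) where
  injective := Fin.val_injective
  subsingleton _ _ := inferInstanceAs (Subsingleton (PLift _))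
  nonempty_iff _ _ := ⟨fun ⟨⟨h⟩⟩ => h, fun h => ⟨⟨h⟩⟩⟩

/-- The vertices keep their positions and the removed ones leave gaps. Unlike type `A` with its
standard labelling, this class is closed under restriction to supports. -/
theorem IsLinear.fullSubquiver {V : Type v} {Q : Quiver.{w} V} {o : ℕ → Bool} {pos : V → ℕ}
    (h : IsLinear Q o pos) (S : Set V) :
    IsLinear (fullSubquiver Q S) o (fun x => pos x) where
  injective := h.injective.comp Subtype.val_injective
  subsingleton x y := h.subsingleton x y
  nonempty_iff x y := h.nonempty_iff x y

/-! ### Extensions, direct sums and idempotents -/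

namespace QuiverRep

variable {k : Type u} [Field k] {V : Type v} {Q : Quiver.{w} V}

theorem subsingleton_ext1_iff (M N : QuiverRep k Q) :
    Subsingleton (Ext1 M N) ↔ Function.Surjective (extMap M N) := by
  rw [Submodule.Quotient.subsingleton_iff, LinearMap.range_eq_top]

theorem extMap_apply (M N : QuiverRep k Q) (f : ∀ x, M.space x →ₗ[k] N.space x) (x y : V)
    (a : @Quiver.Hom V Q x y) (m : M.space x) :
    extMap M N f x y a m = N.map a (f x m) - f y (M.map a m) := rfl

/-- The inclusion of a summand into a direct sum, at a vertex. -/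
def incl {ι : Type} [Finite ι] [DecidableEq ι] (T : ι → QuiverRep k Q) (i : ι) (x : V) :
    (T i).space x →ₗ[k] (directSum T).space x :=
  (LinearMap.single k (fun l => (T l).space x) i : _ →ₗ[k] ∀ l, (T l).space x)

/-- The projection of a direct sum onto a summand, at a vertex. -/
def proj {ι : Type} [Finite ι] (T : ι → QuiverRep k Q) (i : ι) (x : V) :
    (directSum T).space x →ₗ[k] (T i).space x :=
  (LinearMap.proj i : (∀ l, (T l).space x) →ₗ[k] (T i).space x)

section directSum

variable {ι : Type} [Finite ι] (T : ι → QuiverRep k Q)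

theorem proj_map {x y : V} (a : @Quiver.Hom V Q x y) (m : (directSum T).space x) (i : ι) :
    proj T i y ((directSum T).map a m) = (T i).map a (proj T i x m) := rfl

theorem directSum_ext {x : V} {m m' : (directSum T).space x}
    (h : ∀ i, proj T i x m = proj T i x m') : m = m' :=
  funext h

variable [DecidableEq ι]

theorem proj_incl_same (i : ι) (x : V) (m : (T i).space x) :
    proj T i x (incl T i x m) = m :=
  Pi.single_eq_same (M := fun l => (T l).space x) i m

theorem proj_incl_of_ne {i j : ι} (h : j ≠ i) (x : V) (m : (T i).space x) :
    proj T j x (incl T i x m) = 0 :=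
  Pi.single_eq_of_ne (M := fun l => (T l).space x) h m

theorem map_incl {x y : V} (a : @Quiver.Hom V Q x y) (i : ι) (m : (T i).space x) :
    (directSum T).map a (incl T i x m) = incl T i y ((T i).map a m) := by
  refine directSum_ext T fun l => ?_
  rw [proj_map]
  by_cases hl : l = i
  · subst hl; rw [proj_incl_same, proj_incl_same]
  · rw [proj_incl_of_ne T hl, proj_incl_of_ne T hl, map_zero]

theorem directSum_hom_ext {x : V} {W : Type*} [AddCommGroup W] [Module k W]
    {f g : (directSum T).space x →ₗ[k] W}
    (h : ∀ i m, f (incl T i x m) = g (incl T i x m)) : f = g := by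
  exact LinearMap.pi_ext (φ := fun l => (T l).space x) h

end directSum

/-- Families of maps between direct sums are matrices, and `extMap` acts on them entry by entry. -/
theorem subsingleton_ext1_directSum_iff {ι : Type} [Finite ι] (T : ι → QuiverRep k Q) :
    Subsingleton (Ext1 (directSum T) (directSum T)) ↔
      ∀ i j, Function.Surjective (extMap (T i) (T j)) := by
  classical
  have := Fintype.ofFinite ι
  rw [subsingleton_ext1_iff]
  constructor
  · intro h i j φ
    obtain ⟨f, hf⟩ := h fun x y a => incl T j y ∘ₗ φ x y a ∘ₗ proj T i x
    refine ⟨fun x => proj T j x ∘ₗ f x ∘ₗ incl T i x, ?_⟩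
    funext x y a
    ext m
    have h1 := congrArg (fun g => proj T j y (g (incl T i x m)))
      (congrFun (congrFun (congrFun hf x) y) a)
    simpa only [extMap_apply, LinearMap.comp_apply, map_sub, map_incl, proj_map,
      proj_incl_same] using h1
  · intro h φ
    choose f hf using fun i j => h i j fun x y a => proj T j y ∘ₗ φ x y a ∘ₗ incl T i x
    have h3 : ∀ (i j : ι) (z : V) (m : (T i).space z),
        proj T j z ((∑ i, ∑ j, incl T j z ∘ₗ f i j z ∘ₗ proj T i z) (incl T i z m)) =
          f i j z m := by
      intro i j z m
      rw [LinearMap.sum_apply, Finset.sum_eq_single i, LinearMap.sum_apply, map_sum,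
        Finset.sum_eq_single j]
      · simp only [LinearMap.comp_apply, proj_incl_same]
      · intro b _ hb
        simp only [LinearMap.comp_apply, proj_incl_of_ne T hb.symm]
      · simp
      · intro b _ hb
        simp only [LinearMap.sum_apply, LinearMap.comp_apply, proj_incl_of_ne T hb, map_zero,
          Finset.sum_const_zero]
      · simp
    refine ⟨fun x => ∑ i, ∑ j, incl T j x ∘ₗ f i j x ∘ₗ proj T i x, ?_⟩
    funext x y a
    refine directSum_hom_ext T fun i m => directSum_ext T fun j => ?_
    have h1 := congrArg (fun g => g m) (congrFun (congrFun (congrFun (hf i j) x) y) a)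
    simp only [extMap_apply, LinearMap.comp_apply] at h1
    rw [extMap_apply, map_incl, map_sub, proj_map, h3, h3, h1]

/-- Otherwise pick `m ≠ 0` killed by `M.map a` and `w` outside the range of `N.map a`. A rank one
family sending `m` to `w` is not hit by `extMap`: evaluating a preimage at `m` would put `w` into
the range. -/
theorem injective_or_surjective_of_extMap_surjective {M N : QuiverRep k Q}
    (h : Function.Surjective (extMap M N)) {x y : V} (a : @Quiver.Hom V Q x y) :
    Function.Injective (M.map a) ∨ Function.Surjective (N.map a) := by
  classical
  by_contra! hc
  obtain ⟨h1, h2⟩ := hc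
  rw [← LinearMap.ker_eq_bot, Submodule.eq_bot_iff] at h1
  push Not at h1
  obtain ⟨m, hm, hm0⟩ := h1
  rw [Function.Surjective] at h2
  push Not at h2
  obtain ⟨w, hw⟩ := h2
  obtain ⟨ξ, hξ⟩ : ∃ ξ : Module.Dual k (M.space x), ξ m ≠ 0 := by
    by_contra! h0
    exact hm0 ((Module.forall_dual_apply_eq_zero_iff k m).1 h0)
  obtain ⟨f, hf⟩ := h fun x' y' _ =>
    ((Pi.single x ((ξ m)⁻¹ • ξ) : ∀ z, Module.Dual k (M.space z)) x').smulRight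
      ((Pi.single y w : ∀ z, N.space z) y')
  have h3 := congrArg (fun g => g m) (congrFun (congrFun (congrFun hf x) y) a)
  simp only [extMap_apply, LinearMap.mem_ker.1 hm, map_zero, sub_zero, Pi.single_eq_same,
    LinearMap.smulRight_apply, LinearMap.smul_apply, smul_eq_mul, inv_mul_cancel₀ hξ,
    one_smul] at h3
  exact hw _ h3

/-- The image of an idempotent endomorphism. -/
def endRange (M : QuiverRep k Q) (e : ∀ x, M.space x →ₗ[k] M.space x)
    (he : ∀ (x y : V) (a : @Quiver.Hom V Q x y) (m : M.space x),
      M.map a (e x m) = e y (M.map a m)) : QuiverRep k Q where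
  space x := LinearMap.range (e x)
  map {x y} a := (M.map a).restrict (by rintro _ ⟨m, rfl⟩; exact ⟨_, (he x y a m).symm⟩)

/-- The kernel of an endomorphism. -/
def endKer (M : QuiverRep k Q) (e : ∀ x, M.space x →ₗ[k] M.space x)
    (he : ∀ (x y : V) (a : @Quiver.Hom V Q x y) (m : M.space x),
      M.map a (e x m) = e y (M.map a m)) : QuiverRep k Q where
  space x := LinearMap.ker (e x)
  map {x y} a := (M.map a).restrict (by
    intro m hm
    rw [LinearMap.mem_ker] at hm ⊢
    rw [← he, hm, map_zero])

theorem Indecomposable.eq_id_of_idempotent {M : QuiverRep k Q} (hM : M.Indecomposable)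
    (e : ∀ x, M.space x →ₗ[k] M.space x)
    (he : ∀ (x y : V) (a : @Quiver.Hom V Q x y) (m : M.space x),
      M.map a (e x m) = e y (M.map a m))
    (hid : ∀ x m, e x (e x m) = e x m) (hne : ∃ x m, e x m ≠ 0) (x : V) (m : M.space x) :
    e x m = m := by
  have hc : ∀ x, IsCompl (LinearMap.range (e x)) (LinearMap.ker (e x)) := fun x =>
    LinearMap.IsIdempotentElem.isCompl (show IsIdempotentElem (e x) from LinearMap.ext (hid x))
  have hiso : M.Isomorphic ((M.endRange e he).prod (M.endKer e he)) := by
    refine ⟨fun x => (Submodule.prodEquivOfIsCompl _ _ (hc x)).symm, fun x y a m => ?_⟩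
    obtain ⟨m', rfl⟩ := (Submodule.prodEquivOfIsCompl _ _ (hc x)).surjective m
    have h2 : (Submodule.prodEquivOfIsCompl _ _ (hc y)).symm
        (M.map a (Submodule.prodEquivOfIsCompl _ _ (hc x) m')) =
        (((M.endRange e he).prod (M.endKer e he)).map a m' :
          LinearMap.range (e y) × LinearMap.ker (e y)) := by
      exact (LinearEquiv.symm_apply_eq _).2 (map_add (M.map a) (m'.1 : M.space x) m'.2)
    refine h2.trans (congrArg (((M.endRange e he).prod (M.endKer e he)).map a) ?_)
    exact (LinearEquiv.symm_apply_apply _ _).symm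
  rcases hM.2 _ _ hiso with h | h
  · obtain ⟨x, m, hm⟩ := hne
    have : Subsingleton (LinearMap.range (e x)) := h x
    exact absurd (congrArg Subtype.val
      (Subsingleton.elim (⟨e x m, m, rfl⟩ : LinearMap.range (e x)) 0)) hm
  · have : Subsingleton (LinearMap.ker (e x)) := h x
    have h0 := congrArg Subtype.val (Subsingleton.elim
      (⟨m - e x m, by simp [hid]⟩ : LinearMap.ker (e x)) 0)
    exact (sub_eq_zero.1 h0).symm

end QuiverRep

/-! ### Indecomposable representations of linear quivers are intervals -/

theorem exists_least_of_isChain {α : Type*} [PartialOrder α] [WellFoundedLT α] {C : Set α}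
    (hC : IsChain (· ≤ ·) C) {P : α → Prop} (h : ∃ F ∈ C, P F) :
    ∃ F ∈ C, P F ∧ ∀ F' ∈ C, P F' → F ≤ F' := by
  obtain ⟨F, ⟨hF, hP⟩, hmin⟩ := WellFounded.has_min (wellFounded_lt (α := α))
    {F | F ∈ C ∧ P F} (by obtain ⟨F, h1, h2⟩ := h; exact ⟨F, h1, h2⟩)
  refine ⟨F, hF, hP, fun F' hF' hP' => ?_⟩
  rcases hC.total hF hF' with h1 | h1
  · exact h1
  · exact (eq_of_le_of_not_lt h1 (hmin F' ⟨hF', hP'⟩)).ge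

theorem exists_greatest_of_isChain {α : Type*} [PartialOrder α] [WellFoundedGT α] {C : Set α}
    (hC : IsChain (· ≤ ·) C) {P : α → Prop} (h : ∃ F ∈ C, P F) :
    ∃ F ∈ C, P F ∧ ∀ F' ∈ C, P F' → F' ≤ F := by
  obtain ⟨F, ⟨hF, hP⟩, hmin⟩ := WellFounded.has_min (wellFounded_gt (α := α))
    {F | F ∈ C ∧ P F} (by obtain ⟨F, h1, h2⟩ := h; exact ⟨F, h1, h2⟩)
  refine ⟨F, hF, hP, fun F' hF' hP' => ?_⟩
  rcases hC.total hF hF' with h1 | h1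
  · exact (eq_of_le_of_not_lt h1 (hmin F' ⟨hF', hP'⟩)).ge
  · exact h1

theorem IsChain.insert_top {α : Type*} [PartialOrder α] [OrderTop α] {C : Set α}
    (hC : IsChain (· ≤ ·) C) : IsChain (· ≤ ·) (insert ⊤ C) :=
  hC.insert fun _ _ _ => Or.inr le_top

theorem IsChain.insert_bot {α : Type*} [PartialOrder α] [OrderBot α] {C : Set α}
    (hC : IsChain (· ≤ ·) C) : IsChain (· ≤ ·) (insert ⊥ C) :=
  hC.insert fun _ _ _ => Or.inl bot_le

namespace QuiverRep

variable {k : Type u} [Field k] {V : Type v} {Q : Quiver.{w} V}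

/-- The maps `m ↦ φ x m • v x` form, on the vertices at positions `≥ p`, an idempotent endomorphism
of `M` of rank one at the positions `r, …, s` and of rank zero at the other ones. -/
structure IsBar (M : QuiverRep k Q) (pos : V → ℕ) (p r s : ℕ) (v : ∀ x, M.space x)
    (φ : ∀ x, Module.Dual k (M.space x)) : Prop where
  le_left : p ≤ r
  le : r ≤ s
  one : ∀ x, r ≤ pos x → pos x ≤ s → φ x (v x) = 1
  zero : ∀ x, ¬ (r ≤ pos x ∧ pos x ≤ s) → v x = 0 ∧ φ x = 0
  mem : ∀ i, r ≤ i → i ≤ s → i ∈ Set.range pos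
  comm : ∀ (x y : V) (a : @Quiver.Hom V Q x y), p ≤ pos x → p ≤ pos y → ∀ m,
    M.map a (φ x m • v x) = φ y (M.map a m) • v y

variable {o : ℕ → Bool} {pos : V → ℕ} {M : QuiverRep k Q} {p r s : ℕ} {v : ∀ x, M.space x}
  {φ : ∀ x, Module.Dual k (M.space x)}

theorem _root_.IsLinear.pos_eq (hQ : IsLinear Q o pos) {x y : V} (a : @Quiver.Hom V Q x y) :
    pos x + 1 = pos y ∨ pos y + 1 = pos x :=
  ((hQ.nonempty_iff x y).1 ⟨a⟩).imp And.left And.left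

theorem _root_.IsLinear.isEmpty_symm (hQ : IsLinear Q o pos) {x y : V}
    (a : @Quiver.Hom V Q x y) : IsEmpty (@Quiver.Hom V Q y x) := by
  by_contra h
  rw [not_isEmpty_iff] at h
  have h1 := (hQ.nonempty_iff x y).1 ⟨a⟩
  have h2 := (hQ.nonempty_iff y x).1 h
  rcases h1 with h1 | h1 <;> rcases h2 with h2 | h2
  · omega
  · simp [h1.2] at h2
  · simp [h1.2] at h2
  · omega

/-- The bar is zero at position `p`, so the only new commutativity conditions come from the edge
between `p` and `p + 1`. -/
theorem IsBar.weaken (hQ : IsLinear Q o pos) (h : M.IsBar pos (p + 1) r s v φ)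
    (hout : ∀ (x y : V) (a : @Quiver.Hom V Q x y), pos x = p → pos y = p + 1 → ∀ m,
      φ y (M.map a m) • v y = 0)
    (hin : ∀ (x y : V) (a : @Quiver.Hom V Q x y), pos x = p + 1 → pos y = p → ∀ m,
      M.map a (φ x m • v x) = 0) : M.IsBar pos p r s v φ where
  le_left := by have := h.le_left; omega
  le := h.le
  one := h.one
  zero := h.zero
  mem := h.mem
  comm x y a hx hy m := by
    have hr := h.le_left
    rcases hQ.pos_eq a with hp | hp
    · rcases eq_or_lt_of_le hx with hx' | hx'
      · rw [hout x y a hx'.symm (by omega), (h.zero x (by omega)).1, smul_zero, map_zero]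
      · exact h.comm x y a (by omega) (by omega) m
    · rcases eq_or_lt_of_le hy with hy' | hy'
      · rw [hin x y a (by omega) hy'.symm, (h.zero y (by omega)).1, smul_zero]
      · exact h.comm x y a (by omega) (by omega) m

theorem IsBar.extend [DecidableEq V] (hQ : IsLinear Q o pos)
    (h : M.IsBar pos (p + 1) (p + 1) s v φ) {x₀ : V} (hx₀ : pos x₀ = p) {w : M.space x₀}
    {ψ : Module.Dual k (M.space x₀)} (hw : ψ w = 1)
    (hout : ∀ (y : V) (a : @Quiver.Hom V Q x₀ y), pos y = p + 1 → ∀ m,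
      M.map a (ψ m • w) = φ y (M.map a m) • v y)
    (hin : ∀ (y : V) (a : @Quiver.Hom V Q y x₀), pos y = p + 1 → ∀ m,
      M.map a (φ y m • v y) = ψ (M.map a m) • w) :
    M.IsBar pos p p s (Function.update v x₀ w) (Function.update φ x₀ ψ) where
  le_left := le_rfl
  le := by have := h.le; omega
  one x h1 h2 := by
    by_cases hx : x = x₀
    · subst hx; simpa using hw
    · have : pos x ≠ pos x₀ := fun h => hx (hQ.injective h)
      simpa [hx] using h.one x (by omega) h2
  zero x h1 := by
    have := h.le
    have hx : x ≠ x₀ := by rintro rfl; omega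
    simpa [hx] using h.zero x (by omega)
  mem i h1 h2 := by
    rcases eq_or_lt_of_le h1 with rfl | h1
    · exact ⟨x₀, hx₀⟩
    · exact h.mem i h1 h2
  comm x y a hx hy m := by
    have hne : ∀ z, pos z ≠ p → z ≠ x₀ := by rintro z hz rfl; exact hz hx₀
    rcases hQ.pos_eq a with hp | hp
    · rcases eq_or_lt_of_le hx with hx' | hx'
      · obtain rfl : x = x₀ := hQ.injective (by omega)
        have hy' := hne y (by omega)
        simpa [hy'] using hout y a (by omega) m
      · have hy' := hne y (by omega)
        have hx' := hne x (by omega)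
        simpa [hy', hx'] using h.comm x y a (by omega) (by omega) m
    · rcases eq_or_lt_of_le hy with hy' | hy'
      · obtain rfl : y = x₀ := hQ.injective (by omega)
        have hx' := hne x (by omega)
        simpa [hx'] using hin x a (by omega) m
      · have hy' := hne y (by omega)
        have hx' := hne x (by omega)
        simpa [hy', hx'] using h.comm x y a (by omega) (by omega) m

theorem exists_isBar_of_subsingleton [DecidableEq V] (hQ : IsLinear Q o pos) {x₀ : V}
    (hx₀ : pos x₀ = p) [Nontrivial (M.space x₀)]
    (hsub : ∀ x, p + 1 ≤ pos x → Subsingleton (M.space x))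
    (C : Set (Submodule k (M.space x₀))) (hC : IsChain (· ≤ ·) C) :
    ∃ v φ, M.IsBar pos p p p v φ ∧ ∀ F ∈ C, ∀ m ∈ F, φ x₀ m • v x₀ ∈ F := by
  -- A nonzero vector of the least nonzero member of the chain lies in every nonzero member, so any
  -- rank one map onto its line preserves the chain.
  obtain ⟨F, -, hF, hmin⟩ := exists_least_of_isChain hC.insert_top
    (P := fun F => F ≠ ⊥) ⟨⊤, Set.mem_insert _ _, top_ne_bot⟩
  obtain ⟨w, hwF, hw⟩ := Submodule.exists_mem_ne_zero_of_ne_bot hF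
  obtain ⟨ξ, hξ⟩ : ∃ ξ : Module.Dual k (M.space x₀), ξ w ≠ 0 := by
    by_contra! h0
    exact hw ((Module.forall_dual_apply_eq_zero_iff k w).1 h0)
  have hne : ∀ z, pos z ≠ p → z ≠ x₀ := by rintro z hz rfl; exact hz hx₀
  refine ⟨Pi.single x₀ w, Pi.single x₀ ((ξ w)⁻¹ • ξ), ⟨le_rfl, le_rfl, ?_, ?_, ?_, ?_⟩, ?_⟩
  · intro x h1 h2
    obtain rfl : x = x₀ := hQ.injective (by omega)
    simp [hξ]
  · intro x hx
    have hx' := hne x (by omega)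
    simp [hx']
  · intro i h1 h2
    exact ⟨x₀, by omega⟩
  · intro x y a hx hy m
    rcases hQ.pos_eq a with hp | hp
    · have := hsub y (by omega)
      exact Subsingleton.elim _ _
    · have := hsub x (by omega)
      rw [Subsingleton.elim m 0]
      simp
  · intro F' hF' m hm
    by_cases h0 : F' = ⊥
    · subst h0
      rw [(Submodule.mem_bot k).1 hm]
      simp
    · rw [Pi.single_eq_same, Pi.single_eq_same]
      exact F'.smul_mem _ (hmin F' (Set.mem_insert_of_mem _ hF') h0 hwF)

/-- If `v y₀` is nonzero and in the range of the arrow, the bar extends to `x₀` by lifting it. If it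
is outside the range, then `φ y₀` vanishes on the range because the range, the image of `⊤`, is
preserved; so the bar ends at `y₀`. -/
theorem IsBar.exists_of_hom_out [DecidableEq V] (hQ : IsLinear Q o pos)
    (h : M.IsBar pos (p + 1) r s v φ) {x₀ y₀ : V} (hx₀ : pos x₀ = p) (hy₀ : pos y₀ = p + 1)
    (a : @Quiver.Hom V Q x₀ y₀) (C : Set (Submodule k (M.space x₀))) (hC : IsChain (· ≤ ·) C)
    (hp : ∀ F ∈ insert ⊤ C, ∀ m ∈ F.map (M.map a), φ y₀ m • v y₀ ∈ F.map (M.map a)) :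
    ∃ r s v φ, M.IsBar pos p r s v φ ∧ ∀ F ∈ C, ∀ m ∈ F, φ x₀ m • v x₀ ∈ F := by
  have hy : ∀ y, pos y = p + 1 → y = y₀ := fun y hy => hQ.injective (hy.trans hy₀.symm)
  have hx : ∀ x, pos x = p → x = x₀ := fun y hy => hQ.injective (hy.trans hx₀.symm)
  by_cases hv : v y₀ ∈ LinearMap.range (M.map a) ∧ v y₀ ≠ 0
  · obtain ⟨hv, hv0⟩ := hv
    have hin : r ≤ pos y₀ ∧ pos y₀ ≤ s := by
      by_contra h0
      exact hv0 (h.zero y₀ h0).1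
    obtain rfl : r = p + 1 := by have := h.le_left; omega
    -- The lift `w` is taken in the least member whose image contains `v y₀`. A member on which the
    -- new functional is nonzero has `v y₀` in its image, so it contains `w`.
    obtain ⟨F, -, hF, hmin⟩ := exists_least_of_isChain hC.insert_top
      (P := fun F => v y₀ ∈ F.map (M.map a))
      ⟨⊤, Set.mem_insert _ _, by rwa [Submodule.map_top]⟩
    obtain ⟨w, hwF, hw⟩ := hF
    refine ⟨p, s, _, _, h.extend hQ hx₀ (w := w) (ψ := φ y₀ ∘ₗ M.map a) ?_ ?_ ?_, ?_⟩
    · rw [LinearMap.comp_apply, hw]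
      exact h.one y₀ hin.1 hin.2
    · intro y b hyp m
      obtain rfl := hy y hyp
      obtain rfl := (hQ.subsingleton x₀ y).elim a b
      rw [map_smul, hw]; rfl
    · intro y b hyp m
      obtain rfl := hy y hyp
      exact ((hQ.isEmpty_symm a).false b).elim
    · intro F' hF' m hm
      rw [Function.update_self, Function.update_self, LinearMap.comp_apply]
      by_cases h0 : φ y₀ (M.map a m) = 0
      · rw [h0, zero_smul]; exact F'.zero_mem
      · refine F'.smul_mem _ (hmin F' (Set.mem_insert_of_mem _ hF') ?_ hwF)
        have := hp F' (Set.mem_insert_of_mem _ hF') _ (Submodule.mem_map_of_mem hm)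
        exact ((F'.map (M.map a)).smul_mem_iff h0).1 this
  · refine ⟨r, s, v, φ, h.weaken hQ ?_ ?_, ?_⟩
    · intro x y b hxp hyp m
      obtain rfl := hy y hyp
      obtain rfl := hx x hxp
      obtain rfl := (hQ.subsingleton x y).elim a b
      have h1 := hp ⊤ (Set.mem_insert _ _) (M.map a m) (Submodule.mem_map_of_mem trivial)
      by_cases h0 : φ y (M.map a m) = 0
      · rw [h0, zero_smul]
      · rw [Submodule.smul_mem_iff _ h0, Submodule.map_top] at h1
        by_contra h2
        exact hv ⟨h1, fun h3 => h2 (by rw [h3, smul_zero])⟩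
    · intro x y b hxp hyp m
      obtain rfl := hy x hxp
      obtain rfl := hx y hyp
      exact ((hQ.isEmpty_symm a).false b).elim
    · intro F _ m _
      have := h.le_left
      rw [(h.zero x₀ (by omega)).1, smul_zero]
      exact F.zero_mem

/-- Dual to the outgoing case: the vector is pushed forward, and it is the functional that has to
descend along the arrow. -/
theorem IsBar.exists_of_hom_in [DecidableEq V] (hQ : IsLinear Q o pos)
    (h : M.IsBar pos (p + 1) r s v φ) {x₀ y₀ : V} (hx₀ : pos x₀ = p) (hy₀ : pos y₀ = p + 1)
    (a : @Quiver.Hom V Q y₀ x₀) (C : Set (Submodule k (M.space x₀))) (hC : IsChain (· ≤ ·) C)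
    (hp : ∀ F ∈ insert ⊥ C, ∀ m ∈ F.comap (M.map a), φ y₀ m • v y₀ ∈ F.comap (M.map a)) :
    ∃ r s v φ, M.IsBar pos p r s v φ ∧ ∀ F ∈ C, ∀ m ∈ F, φ x₀ m • v x₀ ∈ F := by
  have hy : ∀ y, pos y = p + 1 → y = y₀ := fun y hy => hQ.injective (hy.trans hy₀.symm)
  have hx : ∀ x, pos x = p → x = x₀ := fun y hy => hQ.injective (hy.trans hx₀.symm)
  by_cases hv : M.map a (v y₀) = 0
  · refine ⟨r, s, v, φ, h.weaken hQ ?_ ?_, ?_⟩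
    · intro x y b hxp hyp m
      obtain rfl := hx x hxp
      obtain rfl := hy y hyp
      exact ((hQ.isEmpty_symm a).false b).elim
    · intro x y b hxp hyp m
      obtain rfl := hx y hyp
      obtain rfl := hy x hxp
      obtain rfl := (hQ.subsingleton x y).elim a b
      rw [map_smul, hv, smul_zero]
    · intro F _ m _
      have := h.le_left
      rw [(h.zero x₀ (by omega)).1, smul_zero]
      exact F.zero_mem
  · have hin : r ≤ pos y₀ ∧ pos y₀ ≤ s := by
      by_contra h0
      exact hv (by rw [(h.zero y₀ h0).1, map_zero])
    obtain rfl : r = p + 1 := by have := h.le_left; omega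
    obtain ⟨F, hFC, hF, hmax⟩ := exists_greatest_of_isChain hC.insert_bot
      (P := fun F => M.map a (v y₀) ∉ F)
      ⟨⊥, Set.mem_insert _ _, by rwa [Submodule.mem_bot]⟩
    -- The preimage of `F` is preserved and does not contain `v y₀`, so `φ y₀` vanishes on it and
    -- factors through the quotient by `F`. By maximality of `F` the resulting functional kills
    -- every member that misses the image of `v y₀`.
    have hker : φ y₀ ∈ LinearMap.range (F.mkQ ∘ₗ M.map a).dualMap := by
      rw [LinearMap.range_dualMap_eq_dualAnnihilator_ker, Submodule.mem_dualAnnihilator]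
      intro m hm
      rw [LinearMap.mem_ker, LinearMap.comp_apply, Submodule.mkQ_apply,
        Submodule.Quotient.mk_eq_zero] at hm
      by_contra h0
      have := hp F hFC m hm
      rw [Submodule.smul_mem_iff _ h0] at this
      exact hF this
    obtain ⟨ψ, hψ⟩ := hker
    have hψ' : ∀ m, ψ (F.mkQ (M.map a m)) = φ y₀ m := fun m => congrArg (fun g => g m) hψ
    refine ⟨p, s, _, _, h.extend hQ hx₀ (w := M.map a (v y₀)) (ψ := ψ ∘ₗ F.mkQ) ?_ ?_ ?_, ?_⟩
    · rw [LinearMap.comp_apply, hψ']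
      exact h.one y₀ hin.1 hin.2
    · intro y b hyp m
      obtain rfl := hy y hyp
      exact ((hQ.isEmpty_symm a).false b).elim
    · intro y b hyp m
      obtain rfl := hy y hyp
      obtain rfl := (hQ.subsingleton y x₀).elim a b
      rw [map_smul, LinearMap.comp_apply, hψ']
    · intro F' hF' m hm
      rw [Function.update_self, Function.update_self, LinearMap.comp_apply]
      by_cases h0 : M.map a (v y₀) ∈ F'
      · exact F'.smul_mem _ h0
      · have := hmax F' (Set.mem_insert_of_mem _ hF') h0 hm
        rw [Submodule.mkQ_apply, (Submodule.Quotient.mk_eq_zero F).2 this, map_zero, zero_smul]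
        exact F'.zero_mem

/-- Induction from the right end. A bar found to the right of `p` need not be compatible with the
arrow at `p`, so the claim is strengthened: the bar can be made to preserve a prescribed chain of
subspaces at `p`. The chain is transported to `p + 1` by images or preimages, with `⊤` or `⊥` added
to record the range or the kernel of the arrow. -/
theorem exists_isBar_of_chains [DecidableEq V] (hQ : IsLinear Q o pos) (M : QuiverRep k Q)
    {n : ℕ} (hn : ∀ x, pos x < n) :
    ∀ t p, n ≤ p + t → (∃ x, p ≤ pos x ∧ Nontrivial (M.space x)) →
    ∀ C : ∀ x, Set (Submodule k (M.space x)), (∀ x, IsChain (· ≤ ·) (C x)) →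
    ∃ r s v φ, M.IsBar pos p r s v φ ∧
      ∀ x, pos x = p → ∀ F ∈ C x, ∀ m ∈ F, φ x m • v x ∈ F := by
  intro t
  induction t with
  | zero =>
    rintro p hp ⟨x, hx, -⟩
    have := hn x
    omega
  | succ t ih =>
    intro p hpt hex C hC
    by_cases h1 : ∃ x, p + 1 ≤ pos x ∧ Nontrivial (M.space x)
    · by_cases h2 : ∃ (x₀ y₀ : V) (_ : @Quiver.Hom V Q x₀ y₀), pos x₀ = p ∧ pos y₀ = p + 1
      · obtain ⟨x₀, y₀, a, hx₀, hy₀⟩ := h2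
        obtain ⟨r, s, v, φ, hb, hbC⟩ := ih (p + 1) (by omega) h1
          (fun y => {G | ∃ (a : @Quiver.Hom V Q x₀ y), ∃ F ∈ insert ⊤ (C x₀),
            G = F.map (M.map a)}) (by
              rintro y _ ⟨a, F, hF, rfl⟩ _ ⟨b, F', hF', rfl⟩ _
              obtain rfl := (hQ.subsingleton x₀ y).elim a b
              exact ((hC x₀).insert_top.total hF hF').imp
                (fun h => Submodule.map_mono h) (fun h => Submodule.map_mono h))
        obtain ⟨r, s, v, φ, hb', hbC'⟩ := hb.exists_of_hom_out hQ hx₀ hy₀ a (C x₀) (hC x₀)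
          fun F hF => hbC y₀ hy₀ _ ⟨a, F, hF, rfl⟩
        refine ⟨r, s, v, φ, hb', fun x hx => ?_⟩
        obtain rfl := hQ.injective (hx.trans hx₀.symm)
        exact hbC'
      · by_cases h3 : ∃ (x₀ y₀ : V) (_ : @Quiver.Hom V Q y₀ x₀), pos x₀ = p ∧ pos y₀ = p + 1
        · obtain ⟨x₀, y₀, a, hx₀, hy₀⟩ := h3
          obtain ⟨r, s, v, φ, hb, hbC⟩ := ih (p + 1) (by omega) h1
            (fun y => {G | ∃ (a : @Quiver.Hom V Q y x₀), ∃ F ∈ insert ⊥ (C x₀),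
              G = F.comap (M.map a)}) (by
                rintro y _ ⟨a, F, hF, rfl⟩ _ ⟨b, F', hF', rfl⟩ _
                obtain rfl := (hQ.subsingleton y x₀).elim a b
                exact ((hC x₀).insert_bot.total hF hF').imp
                  (fun h => Submodule.comap_mono h) (fun h => Submodule.comap_mono h))
          obtain ⟨r, s, v, φ, hb', hbC'⟩ := hb.exists_of_hom_in hQ hx₀ hy₀ a (C x₀) (hC x₀)
            fun F hF => hbC y₀ hy₀ _ ⟨a, F, hF, rfl⟩
          refine ⟨r, s, v, φ, hb', fun x hx => ?_⟩
          obtain rfl := hQ.injective (hx.trans hx₀.symm)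
          exact hbC'
        · obtain ⟨r, s, v, φ, hb, -⟩ := ih (p + 1) (by omega) h1 (fun _ => ∅)
            (fun _ => Set.subsingleton_empty.isChain)
          refine ⟨r, s, v, φ, hb.weaken hQ ?_ ?_, ?_⟩
          · intro x y a hx hy
            exact (h2 ⟨x, y, a, hx, hy⟩).elim
          · intro x y a hx hy
            exact (h3 ⟨y, x, a, hy, hx⟩).elim
          · intro x hx F _ m _
            have := hb.le_left
            rw [(hb.zero x (by omega)).1, smul_zero]
            exact F.zero_mem
    · obtain ⟨x₀, hx₀, hnt⟩ := hex
      have hx₀ : pos x₀ = p := by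
        by_contra h
        exact h1 ⟨x₀, by omega, hnt⟩
      obtain ⟨v, φ, hb, hbC⟩ := exists_isBar_of_subsingleton (M := M) hQ hx₀
        (fun x hx => not_nontrivial_iff_subsingleton.1 fun h => h1 ⟨x, hx, h⟩) (C x₀) (hC x₀)
      refine ⟨p, p, v, φ, hb, fun x hx => ?_⟩
      obtain rfl := hQ.injective (hx.trans hx₀.symm)
      exact hbC

/-- An indecomposable representation of a linear quiver has dimension one at the vertices of an
interval and zero at the other vertices. -/
theorem Indecomposable.exists_interval (hQ : IsLinear Q o pos) {n : ℕ} (hn : ∀ x, pos x < n)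
    (hM : M.Indecomposable) :
    ∃ r s, r ≤ s ∧ s < n ∧ (∀ i, r ≤ i → i ≤ s → i ∈ Set.range pos) ∧
      ∀ x, M.dimVec x = if r ≤ pos x ∧ pos x ≤ s then 1 else 0 := by
  classical
  have hnt : ∃ x, 0 ≤ pos x ∧ Nontrivial (M.space x) := by
    by_contra! h
    exact hM.1 fun x => h x (Nat.zero_le _)
  obtain ⟨r, s, v, φ, hb, -⟩ := exists_isBar_of_chains hQ M hn n 0 (by omega) hnt (fun _ => ∅)
    (fun _ => Set.subsingleton_empty.isChain)
  have hv : ∀ x, r ≤ pos x → pos x ≤ s → v x ≠ 0 := fun x h1 h2 h3 => by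
    simpa [h3] using hb.one x h1 h2
  have hid := hM.eq_id_of_idempotent (fun x => (φ x).smulRight (v x))
    (fun x y a m => hb.comm x y a (Nat.zero_le _) (Nat.zero_le _) m) (fun x m => by
      by_cases h : r ≤ pos x ∧ pos x ≤ s
      · simp [hb.one x h.1 h.2]
      · simp [(hb.zero x h).1]) (by
      obtain ⟨x, hx⟩ := hb.mem r le_rfl hb.le
      refine ⟨x, v x, ?_⟩
      rw [LinearMap.smulRight_apply, hb.one x hx.ge (hx.le.trans hb.le), one_smul]
      exact hv x hx.ge (hx.le.trans hb.le))
  refine ⟨r, s, hb.le, ?_, hb.mem, fun x => ?_⟩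
  · obtain ⟨x, hx⟩ := hb.mem s hb.le le_rfl
    exact hx ▸ hn x
  · rw [dimVec]
    split_ifs with h
    · rw [finrank_eq_one (v x) (hv x h.1 h.2) fun m => ⟨φ x m, hid x m⟩, Nat.cast_one]
    · have : Subsingleton (M.space x) := ⟨fun m m' => by
        rw [← hid x m, ← hid x m', (hb.zero x h).2]; simp⟩
      rw [Module.finrank_zero_of_subsingleton, Nat.cast_zero]

end QuiverRep

/-! ### Combinatorics: decomposing a vector into compatible intervals -/

theorem exists_split_of_le_sum {ι : Type*} (ρ : ι → ℤ)
    (hρ : Function.Injective ρ) (w : ι → ℝ) (O : Finset ι) :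
    ∀ D, 0 ≤ D → D ≤ ∑ a ∈ O, w a → O.Nonempty →
      ∃ c ∈ O, ∑ a ∈ O with ρ a < ρ c, w a ≤ D ∧ D ≤ ∑ a ∈ O with ρ a < ρ c, w a + w c := by
  classical
  induction O using Finset.induction_on_max_value ρ with
  | empty => simp
  | insert c s hc hmax ih =>
    intro D hD hle _
    by_cases h : D ≤ ∑ a ∈ s, w a ∧ s.Nonempty
    · obtain ⟨b, hb, h1, h2⟩ := ih D hD h.1 h.2
      refine ⟨b, Finset.mem_insert_of_mem hb, ?_⟩
      rw [Finset.filter_insert, if_neg (hmax b hb).not_gt]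
      exact ⟨h1, h2⟩
    · refine ⟨c, Finset.mem_insert_self _ _, ?_⟩
      rw [Finset.filter_insert, if_neg (lt_irrefl _), Finset.filter_true_of_mem fun a ha =>
        lt_of_le_of_ne (hmax a ha) fun h => hc (hρ h ▸ ha)]
      rw [Finset.sum_insert hc, add_comm] at hle
      refine ⟨?_, hle⟩
      rcases s.eq_empty_or_nonempty with rfl | hs
      · simpa using hD
      · by_contra h3
        exact h ⟨(not_le.1 h3).le, hs⟩

/-- The position of the intervals with left end `a` in the order on the intervals containing a
given vertex: the intervals are ordered by the homomorphisms between their left parts. -/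
def leftRank (o : ℕ → Bool) (a : ℕ) : ℤ := if o (a - 1) then a else -a

theorem leftRank_injective (o : ℕ → Bool) : Function.Injective (leftRank o) := by
  intro a b h
  unfold leftRank at h
  split_ifs at h <;> omega

theorem leftRank_lt {o : ℕ → Bool} {a b : ℕ} (h : a < b) (hb : o (b - 1) = true) :
    leftRank o a < leftRank o b := by
  unfold leftRank
  rw [if_pos hb]
  split_ifs <;> omega

theorem lt_leftRank {o : ℕ → Bool} {a b : ℕ} (h : a < b) (hb : o (b - 1) = false) :
    leftRank o b < leftRank o a := by
  unfold leftRank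
  rw [hb]
  split_ifs <;> simp_all; omega

/-- The intervals with left ends `a` and `c`, the first of which has the right end `b` and the
second a larger right end, do not extend each other. -/
def CompatibleAt (o : ℕ → Bool) (a b c : ℕ) : Prop :=
  c ≤ b + 1 → c ≤ b ∧ (o b = true → leftRank o c ≤ leftRank o a) ∧
    (o b = false → leftRank o a ≤ leftRank o c)

/-- A set `C` of pairwise compatible intervals in `A`, together with the intervals
from the elements of `O` to `j - 1`, which are as many as the elements of `A` below `j` and
cover them. -/
structure IsPartialTilting (o : ℕ → Bool) (A : Finset ℕ) (j : ℕ) (C : Finset (ℕ × ℕ))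
    (O : Finset ℕ) : Prop where
  closed : ∀ b ∈ C, b.1 ≤ b.2 ∧ b.2 + 1 < j ∧ ∀ i, b.1 ≤ i → i ≤ b.2 → i ∈ A
  open' : ∀ a ∈ O, a < j ∧ ∀ i, a ≤ i → i < j → i ∈ A
  compat : ∀ b ∈ C, ∀ c ∈ C, b.2 < c.2 → CompatibleAt o b.1 b.2 c.1
  compat_open : ∀ b ∈ C, ∀ c ∈ O, CompatibleAt o b.1 b.2 c
  cover : ∀ i ∈ A, i < j → (∃ b ∈ C, b.1 ≤ i ∧ i ≤ b.2) ∨ ∃ a ∈ O, a ≤ i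
  card : C.card + O.card = {i ∈ A | i < j}.card

variable {o : ℕ → Bool} {A : Finset ℕ} {j : ℕ} {C : Finset (ℕ × ℕ)} {O : Finset ℕ}

theorem card_filter_lt_succ_of_notMem (h : j ∉ A) :
    {i ∈ A | i < j + 1}.card = {i ∈ A | i < j}.card := by
  congr 1
  refine Finset.filter_congr fun i hi => ?_
  have : i ≠ j := fun hij => h (hij ▸ hi)
  omega

theorem card_filter_lt_succ_of_mem (h : j ∈ A) :
    {i ∈ A | i < j + 1}.card = {i ∈ A | i < j}.card + 1 := by
  rw [← Finset.card_insert_of_notMem (a := j) (by simp)]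
  congr 1
  ext i
  simp only [Finset.mem_filter, Finset.mem_insert]
  constructor
  · rintro ⟨h1, h2⟩
    by_cases h3 : i = j
    · exact Or.inl h3
    · exact Or.inr ⟨h1, by omega⟩
  · rintro (rfl | h1)
    · exact ⟨h, by omega⟩
    · exact ⟨h1.1, by omega⟩

/-- Closing some of the open intervals and keeping some of them. -/
theorem IsPartialTilting.split (h : IsPartialTilting o A j C O) {K S : Finset ℕ}
    (hK : K ⊆ O) (hS : S ⊆ O) (hKS : ∀ a ∈ O, a ∈ K ∨ a ∈ S)
    (hA : ∀ a ∈ S, j ∈ A) (hSn : j ∈ A → S.Nonempty)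
    (hcompat : ∀ a ∈ K, ∀ c ∈ S, (o (j - 1) = true → leftRank o c ≤ leftRank o a) ∧
      (o (j - 1) = false → leftRank o a ≤ leftRank o c))
    (hcard : K.card + S.card + {i ∈ A | i < j}.card = O.card + {i ∈ A | i < j + 1}.card) :
    IsPartialTilting o A (j + 1) (C ∪ K.image fun a => (a, j - 1)) S := by
  refine ⟨?_, ?_, ?_, ?_, ?_, ?_⟩
  · intro b hb
    rw [Finset.mem_union, Finset.mem_image] at hb
    rcases hb with hb | ⟨a, ha, rfl⟩
    · exact ⟨(h.closed b hb).1, (h.closed b hb).2.1.trans (by omega), (h.closed b hb).2.2⟩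
    · obtain ⟨h1, h2⟩ := h.open' a (hK ha)
      refine ⟨by simp only; omega, by simp only; omega, fun i hi hi' => h2 i hi ?_⟩
      simp only at hi'
      omega
  · intro a ha
    obtain ⟨h1, h2⟩ := h.open' a (hS ha)
    refine ⟨by omega, fun i hi hi' => ?_⟩
    rcases eq_or_lt_of_le (Nat.lt_succ_iff.1 hi') with rfl | hlt
    · exact hA a ha
    · exact h2 i hi hlt
  · intro b hb c hc hbc
    rw [Finset.mem_union, Finset.mem_image] at hb hc
    rcases hb with hb | ⟨a, ha, rfl⟩
    · rcases hc with hc | ⟨a', ha', rfl⟩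
      · exact h.compat b hb c hc hbc
      · exact h.compat_open b hb a' (hK ha')
    · rcases hc with hc | ⟨a', ha', rfl⟩
      · have := (h.closed c hc).2.1
        simp only at hbc
        omega
      · simp at hbc
  · intro b hb c hc
    rw [Finset.mem_union, Finset.mem_image] at hb
    rcases hb with hb | ⟨a, ha, rfl⟩
    · exact h.compat_open b hb c (hS hc)
    · intro _
      have := (h.open' c (hS hc)).1
      exact ⟨by simp only; omega, hcompat a ha c hc⟩
  · intro i hi hij
    rcases eq_or_lt_of_le (Nat.lt_succ_iff.1 hij) with rfl | hlt
    · obtain ⟨a, ha⟩ := hSn hi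
      exact Or.inr ⟨a, ha, (h.open' a (hS ha)).1.le⟩
    · rcases h.cover i hi hlt with ⟨b, hb, hbi⟩ | ⟨a, ha, hai⟩
      · exact Or.inl ⟨b, Finset.mem_union_left _ hb, hbi⟩
      · rcases hKS a ha with h1 | h1
        · exact Or.inl ⟨(a, j - 1), Finset.mem_union_right _ (Finset.mem_image_of_mem _ h1), hai,
            by simp only; omega⟩
        · exact Or.inr ⟨a, h1, hai⟩
  · have hinj : Function.Injective fun a : ℕ => (a, j - 1) := fun a b hab => by simpa using hab
    rw [Finset.card_union_of_disjoint, Finset.card_image_of_injective _ hinj]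
    · have := h.card
      omega
    · rw [Finset.disjoint_left]
      intro b hb hb'
      rw [Finset.mem_image] at hb'
      obtain ⟨a, -, rfl⟩ := hb'
      have := (h.closed _ hb).2.1
      simp only at this
      omega

/-- Opening a new interval. -/
theorem IsPartialTilting.birth (h : IsPartialTilting o A j C O) (hj : j ∈ A) :
    IsPartialTilting o A (j + 1) C (insert j O) := by
  have hjO : j ∉ O := fun hj => (h.open' j hj).1.false
  refine ⟨?_, ?_, h.compat, ?_, ?_, ?_⟩
  · intro b hb
    exact ⟨(h.closed b hb).1, (h.closed b hb).2.1.trans (by omega), (h.closed b hb).2.2⟩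
  · intro a ha
    rw [Finset.mem_insert] at ha
    rcases ha with rfl | ha
    · exact ⟨by omega, fun i h1 h2 => (by omega : i = a) ▸ hj⟩
    · obtain ⟨h1, h2⟩ := h.open' a ha
      refine ⟨by omega, fun i hi hi' => ?_⟩
      rcases eq_or_lt_of_le (Nat.lt_succ_iff.1 hi') with rfl | hlt
      · exact hj
      · exact h2 i hi hlt
  · intro b hb c hc
    rw [Finset.mem_insert] at hc
    rcases hc with rfl | hc
    · intro h1
      have := (h.closed b hb).2.1
      omega
    · exact h.compat_open b hb c hc
  · intro i hi hij
    rcases eq_or_lt_of_le (Nat.lt_succ_iff.1 hij) with rfl | hlt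
    · exact Or.inr ⟨i, Finset.mem_insert_self _ _, le_rfl⟩
    · exact (h.cover i hi hlt).imp_right fun ⟨a, ha, hai⟩ =>
        ⟨a, Finset.mem_insert_of_mem ha, hai⟩
  · rw [Finset.card_insert_of_notMem hjO, card_filter_lt_succ_of_mem hj, ← h.card]
    ring

/-- A greedy sweep from left to right. The weights of the open intervals add up to the last
coordinate; a larger coordinate opens an interval at `j`, a smaller one closes open intervals in the
order prescribed by compatibility. Zero weights are allowed, so that the number of intervals grows
by exactly one at each vertex of `A`. -/
theorem exists_isPartialTilting (o : ℕ → Bool) (A : Finset ℕ) (d : ℕ → ℝ) (hd : ∀ i, 0 ≤ d i)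
    (hdA : ∀ i, i ∉ A → d i = 0) (j : ℕ) :
    ∃ C O, IsPartialTilting o A j C O ∧ ∃ (w : ℕ × ℕ → ℝ) (w' : ℕ → ℝ), (∀ b, 0 ≤ w b) ∧
      (∀ a, 0 ≤ w' a) ∧ ∀ i < j, d i = ∑ b ∈ C, (if b.1 ≤ i ∧ i ≤ b.2 then w b else 0) +
        ∑ a ∈ O, (if a ≤ i then w' a else 0) := by
  classical
  induction j with
  | zero =>
    exact ⟨∅, ∅, ⟨by simp, by simp, by simp, by simp, by simp, by simp⟩, 0, 0, by simp, by simp,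
      by simp⟩
  | succ j ih =>
    obtain ⟨C, O, h, w, w', hw, hw', hsum⟩ := ih
    have hinj : Function.Injective fun a : ℕ => (a, j - 1) := fun a b hab => by simpa using hab
    have hdisj : ∀ K ⊆ O, Disjoint C (K.image fun a => (a, j - 1)) := by
      intro K hK
      rw [Finset.disjoint_left]
      intro b hb hb'
      rw [Finset.mem_image] at hb'
      obtain ⟨a, ha, rfl⟩ := hb'
      have h1 := (h.closed _ hb).2.1
      simp only at h1
      omega
    have hC0 : ∑ b ∈ C, (if b.1 ≤ j ∧ j ≤ b.2 then w b else 0) = 0 :=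
      Finset.sum_eq_zero fun b hb => if_neg fun hbj => by
        have := (h.closed b hb).2.1
        omega
    have hCw : ∀ (u : ℕ → ℝ) (i : ℕ), ∑ b ∈ C, (if b.1 ≤ i ∧ i ≤ b.2 then
        (if b.2 = j - 1 then u b.1 else w b) else 0) =
        ∑ b ∈ C, (if b.1 ≤ i ∧ i ≤ b.2 then w b else 0) := by
      intro u i
      refine Finset.sum_congr rfl fun b hb => ?_
      have := (h.closed b hb).2.1
      rw [if_neg (c := b.2 = j - 1) (by omega)]
    by_cases hj : j ∈ A
    · by_cases hle : ∑ a ∈ O, w' a ≤ d j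
      · have hjO : j ∉ O := fun hj => (h.open' j hj).1.false
        have hupd : ∀ a ∈ O, Function.update w' j (d j - ∑ a ∈ O, w' a) a = w' a := fun a ha =>
          Function.update_of_ne (by rintro rfl; exact hjO ha) _ _
        refine ⟨C, insert j O, h.birth hj, w, Function.update w' j (d j - ∑ a ∈ O, w' a), hw,
          ?_, ?_⟩
        · intro a
          by_cases ha : a = j
          · subst ha
            simpa using hle
          · simpa [ha] using hw' a
        · intro i hi
          have hO : ∑ a ∈ O, (if a ≤ i then Function.update w' j (d j - ∑ a ∈ O, w' a) a else 0)
              = ∑ a ∈ O, (if a ≤ i then w' a else 0) :=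
            Finset.sum_congr rfl fun a ha => by rw [hupd a ha]
          rw [Finset.sum_insert hjO, hO, Function.update_self]
          rcases eq_or_lt_of_le (Nat.lt_succ_iff.1 hi) with rfl | hlt
          · rw [hC0, if_pos le_rfl, Finset.sum_congr rfl fun a ha =>
              if_pos (h.open' a ha).1.le]
            ring
          · rw [if_neg (by omega), zero_add]
            exact hsum i hlt
      · have hne : O.Nonempty := by
          rw [Finset.nonempty_iff_ne_empty]
          rintro rfl
          exact hle (by simpa using hd j)
        -- The sign follows the arrow between `j - 1` and `j`, so that in both orientations the
        -- intervals of large `ρ` are the ones to be closed.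
        set ρ : ℕ → ℤ := fun a => if o (j - 1) then leftRank o a else -leftRank o a with hρ
        have hρi : Function.Injective ρ := by
          intro a b hab
          simp only [hρ] at hab
          split_ifs at hab
          · exact leftRank_injective o hab
          · exact leftRank_injective o (neg_injective hab)
        -- The partial sums of the weights, in increasing order of `ρ`, cross the level `d j` at
        -- `c`. The interval of `c` is split: a part of weight `δ` stays open and the rest is
        -- closed, which provides the additional interval.
        obtain ⟨c, hc, h1, h2⟩ := exists_split_of_le_sum ρ hρi w' O (d j) (hd j)
          (not_le.1 hle).le hne
        set δ := d j - ∑ a ∈ O with ρ a < ρ c, w' a with hδ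
        have hsplit : ∀ f : ℕ → ℝ, ∑ a ∈ O, f a =
            f c + ∑ a ∈ O with ρ c < ρ a, f a + ∑ a ∈ O with ρ a < ρ c, f a := by
          intro f
          rw [← Finset.sum_filter_add_sum_filter_not O (fun a => ρ a < ρ c), add_comm]
          congr 1
          rw [← Finset.sum_filter_add_sum_filter_not _ (fun a => ρ c < ρ a), add_comm,
            Finset.filter_filter, Finset.filter_filter]
          congr 1
          · rw [Finset.sum_eq_single_of_mem c (by simp [hc])]
            intro b hb hbc
            rw [Finset.mem_filter] at hb
            exact (hbc (hρi (le_antisymm (not_lt.1 hb.2.2) (not_lt.1 hb.2.1)))).elim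
          · refine Finset.sum_congr (Finset.filter_congr fun a _ => ?_) fun _ _ => rfl
            exact ⟨fun h => h.2, fun h => ⟨h.not_gt, h⟩⟩
        have hcK : c ∉ {a ∈ O | ρ c < ρ a} := by simp
        have hcS : c ∉ {a ∈ O | ρ a < ρ c} := by simp
        have hKsub : insert c {a ∈ O | ρ c < ρ a} ⊆ O :=
          Finset.insert_subset hc (Finset.filter_subset _ _)
        have hSsub : insert c {a ∈ O | ρ a < ρ c} ⊆ O :=
          Finset.insert_subset hc (Finset.filter_subset _ _)
        refine ⟨C ∪ (insert c {a ∈ O | ρ c < ρ a}).image fun a => (a, j - 1),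
          insert c {a ∈ O | ρ a < ρ c}, h.split hKsub hSsub ?_ (fun _ _ => hj)
            (fun _ => Finset.insert_nonempty _ _) ?_ ?_,
          fun b => if b.2 = j - 1 then (if b.1 = c then w' c - δ else w' b.1) else w b,
          fun a => if a = c then δ else w' a, ?_, ?_, ?_⟩
        · intro a ha
          simp only [Finset.mem_insert, Finset.mem_filter]
          rcases lt_trichotomy (ρ a) (ρ c) with h3 | h3 | h3
          · exact Or.inr (Or.inr ⟨ha, h3⟩)
          · exact Or.inl (Or.inl (hρi h3))
          · exact Or.inl (Or.inr ⟨ha, h3⟩)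
        · intro a ha b hb
          have h3 : ρ b ≤ ρ a := by
            simp only [Finset.mem_insert, Finset.mem_filter] at ha hb
            have h4 : ρ c ≤ ρ a := by
              rcases ha with rfl | ha
              · exact le_rfl
              · exact ha.2.le
            have h5 : ρ b ≤ ρ c := by
              rcases hb with rfl | hb
              · exact le_rfl
              · exact hb.2.le
            exact h5.trans h4
          simp only [hρ] at h3
          constructor
          · intro h4
            simpa [h4] using h3
          · intro h4
            simpa [h4] using h3
        · rw [card_filter_lt_succ_of_mem hj, Finset.card_insert_of_notMem hcK,
            Finset.card_insert_of_notMem hcS]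
          have h3 := hsplit fun _ => 1
          simp only [Finset.sum_const, nsmul_eq_mul, mul_one] at h3
          have h4 : O.card = 1 + {a ∈ O | ρ c < ρ a}.card + {a ∈ O | ρ a < ρ c}.card := by
            exact_mod_cast h3
          omega
        · intro b
          simp only
          split_ifs
          · linarith
          · exact hw' _
          · exact hw _
        · intro a
          simp only
          split_ifs
          · linarith
          · exact hw' _
        · intro i hi
          have hS : ∀ f : ℕ → ℝ, ∑ a ∈ O with ρ a < ρ c, (if a ≤ i then
              (if a = c then δ else f a) else 0) =
              ∑ a ∈ O with ρ a < ρ c, (if a ≤ i then f a else 0) := fun f =>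
            Finset.sum_congr rfl fun a ha => by
              rw [if_neg (c := a = c) (by rintro rfl; exact hcS ha)]
          have hK : ∀ f : ℕ → ℝ, ∑ a ∈ O with ρ c < ρ a, (if a ≤ i ∧ i ≤ j - 1 then
              (if a = c then w' c - δ else f a) else 0) =
              ∑ a ∈ O with ρ c < ρ a, (if a ≤ i ∧ i ≤ j - 1 then f a else 0) := fun f =>
            Finset.sum_congr rfl fun a ha => by
              rw [if_neg (c := a = c) (by rintro rfl; exact hcK ha)]
          rw [Finset.sum_union (hdisj _ hKsub), hCw fun a => if a = c then w' c - δ else w' a,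
            Finset.sum_image fun a _ b _ hab => hinj hab]
          simp only [if_true]
          rw [Finset.sum_insert hcK, Finset.sum_insert hcS, hS, hK, if_pos rfl, if_pos rfl]
          rcases eq_or_lt_of_le (Nat.lt_succ_iff.1 hi) with rfl | hlt
          · have hlt : i - 1 < i := by have := (h.open' c hc).1; omega
            rw [hC0, if_neg (by omega), Finset.sum_eq_zero fun a _ => if_neg (by omega),
              if_pos (h.open' c hc).1.le, Finset.sum_congr rfl fun a ha =>
              if_pos (h.open' a (Finset.mem_filter.1 ha).1).1.le]
            simp [hδ]
          · have hi' : i ≤ j - 1 := by omega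
            rw [hsum i hlt, hsplit]
            simp only [hi', and_true]
            split_ifs <;> ring
    -- At a gap of `A` all open intervals are closed; the coordinate there is zero and the number of
    -- intervals stays the same.
    · have hOemp : ∀ a ∈ O, a ≤ j - 1 ∧ j - 1 < j := fun a ha => by
        have := (h.open' a ha).1
        omega
      refine ⟨C ∪ O.image fun a => (a, j - 1), ∅, h.split subset_rfl (Finset.empty_subset _)
        (fun a ha => Or.inl ha) (by simp) (fun h => (hj h).elim) (by simp) ?_,
        fun b => if b.2 = j - 1 then w' b.1 else w b, 0, ?_, by simp, ?_⟩
      · rw [card_filter_lt_succ_of_notMem hj, Finset.card_empty, add_zero]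
      · intro b
        simp only
        split_ifs
        · exact hw' _
        · exact hw _
      · intro i hi
        rw [Finset.sum_union (hdisj _ subset_rfl), hCw, Finset.sum_empty, add_zero,
          Finset.sum_image fun a _ b _ hab => hinj hab]
        simp only [if_true]
        rcases eq_or_lt_of_le (Nat.lt_succ_iff.1 hi) with rfl | hlt
        · rw [hC0, hdA i hj, Finset.sum_eq_zero fun a ha => if_neg (by
            have := (h.open' a ha).1
            omega), add_zero]
        · have hi' : i ≤ j - 1 := by omega
          rw [hsum i hlt]
          simp only [hi', and_true]

/-- A set of pairwise compatible intervals in `A`, as many as the elements of `A`, which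
cover `A`. -/
structure IsTiltingSet (o : ℕ → Bool) (A : Finset ℕ) (C : Finset (ℕ × ℕ)) : Prop where
  interval : ∀ b ∈ C, b.1 ≤ b.2 ∧ ∀ i, b.1 ≤ i → i ≤ b.2 → i ∈ A
  compat : ∀ b ∈ C, ∀ c ∈ C, b.2 < c.2 → CompatibleAt o b.1 b.2 c.1
  cover : ∀ i ∈ A, ∃ b ∈ C, b.1 ≤ i ∧ i ≤ b.2
  card : C.card = A.card

theorem exists_isTiltingSet (o : ℕ → Bool) (A : Finset ℕ) (d : ℕ → ℝ) (hd : ∀ i, 0 ≤ d i)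
    (hdA : ∀ i, i ∉ A → d i = 0) :
    ∃ C, IsTiltingSet o A C ∧ ∃ w : ℕ × ℕ → ℝ, (∀ b, 0 ≤ w b) ∧
      ∀ i, d i = ∑ b ∈ C, if b.1 ≤ i ∧ i ≤ b.2 then w b else 0 := by
  obtain ⟨n, hn⟩ : ∃ n, ∀ i ∈ A, i < n :=
    ⟨A.sup id + 1, fun i hi => Nat.lt_succ_of_le (Finset.le_sup (f := id) hi)⟩
  obtain ⟨C, O, h, w, w', hw, -, hsum⟩ := exists_isPartialTilting o A d hd hdA (n + 1)
  -- The sweep passes the position `n`, which is not in `A`; an interval still open would contain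
  -- it.
  have hO : O = ∅ := by
    rw [Finset.eq_empty_iff_forall_notMem]
    intro a ha
    obtain ⟨h1, h2⟩ := h.open' a ha
    exact (hn n (h2 n (by omega) (by omega))).false
  subst hO
  refine ⟨C, ⟨fun b hb => ⟨(h.closed b hb).1, (h.closed b hb).2.2⟩, h.compat, fun i hi => ?_, ?_⟩,
    w, hw, fun i => ?_⟩
  · simpa using h.cover i hi ((hn i hi).trans (by omega))
  · rw [← add_zero C.card, ← Finset.card_empty (α := ℕ), h.card, Finset.filter_true_of_mem]
    intro i hi
    exact (hn i hi).trans (by omega)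
  · by_cases hi : i < n + 1
    · simpa using hsum i hi
    · rw [hdA i fun hiA => hi ((hn i hiA).trans (by omega)), Finset.sum_eq_zero]
      intro b hb
      have := (h.closed b hb).2.1
      exact if_neg (by omega)

/-! ### Interval representations and the tilting modules they form -/

theorem exists_seq_forward {α : Type*} [Nonempty α] {E : ℕ → α → α → Prop}
    (h : ∀ i s, ∃ t, E i s t) : ∃ s : ℕ → α, ∀ i, E i (s i) (s (i + 1)) := by
  choose f hf using h
  exact ⟨Nat.rec (Classical.arbitrary α) f, fun i => hf i _⟩

theorem exists_seq_backward {α : Type*} [Nonempty α] {E : ℕ → α → α → Prop}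
    (h : ∀ i t, ∃ s, E i s t) (n : ℕ) : ∃ s : ℕ → α, ∀ i < n, E i (s i) (s (i + 1)) := by
  induction n generalizing E with
  | zero => exact ⟨fun _ => Classical.arbitrary α, by simp⟩
  | succ n ih =>
    obtain ⟨s, hs⟩ := ih (E := fun i => E (i + 1)) fun i => h (i + 1)
    obtain ⟨t, ht⟩ := h 0 (s 0)
    refine ⟨fun i => Nat.casesOn i t s, fun i hi => ?_⟩
    cases i with
    | zero => exact ht
    | succ i => exact hs i (by omega)

section thinHom

variable {k : Type u} [Field k] (p q r : Prop)

open Classical in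
/-- The canonical map between the spaces which are one-dimensional or zero according to whether
`p` and `q` hold. -/
def thinHom : (PLift p → k) →ₗ[k] (PLift q → k) :=
  LinearMap.pi fun _ => if h : p then LinearMap.proj ⟨h⟩ else 0

variable {p q r}

theorem thinHom_apply (hp : p) (m : PLift p → k) (j : PLift q) :
    thinHom p q m j = m ⟨hp⟩ := by
  simp [thinHom, hp]

theorem eq_smul_thinHom (g : (PLift p → k) →ₗ[k] (PLift q → k)) :
    ∃ c : k, g = c • thinHom p q := by
  by_cases hp : p
  · by_cases hq : q
    · refine ⟨g 1 ⟨hq⟩, LinearMap.ext fun m => funext fun j => ?_⟩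
      have hm : m = m ⟨hp⟩ • 1 := by
        funext i
        simp
      rw [LinearMap.smul_apply, Pi.smul_apply, thinHom_apply hp]
      conv_lhs => rw [hm]
      rw [map_smul, Pi.smul_apply, smul_eq_mul, smul_eq_mul, mul_comm]
    · exact ⟨0, LinearMap.ext fun m => funext fun j => (hq j.down).elim⟩
  · refine ⟨0, LinearMap.ext fun m => ?_⟩
    have : m = 0 := funext fun j => (hp j.down).elim
    rw [this, map_zero, map_zero]

open Classical in
theorem thinHom_comp (m : PLift p → k) :
    thinHom q r (thinHom p q m) = (if q then (1 : k) else 0) • thinHom p r m := by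
  funext j
  by_cases hp : p
  · by_cases hq : q
    · rw [thinHom_apply hq, thinHom_apply hp, if_pos hq, one_smul, thinHom_apply hp]
    · simp [thinHom, hq]
  · have : m = 0 := funext fun j => (hp j.down).elim
    simp [this]

theorem thinHom_injective (hq : q) : Function.Injective (thinHom (k := k) p q) := by
  intro m m' h
  funext j
  have := congrFun h ⟨hq⟩
  rwa [thinHom_apply j.down, thinHom_apply j.down] at this

theorem thinHom_eq_zero (h : ¬ (p ∧ q)) : thinHom (k := k) p q = 0 := by
  ext m j
  by_cases hp : p
  · exact (h ⟨hp, j.down⟩).elim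
  · simp [thinHom, hp]

end thinHom

namespace QuiverRep

variable {k : Type u} [Field k] {V : Type v} {Q : Quiver.{w} V} {o : ℕ → Bool} {pos : V → ℕ}

/-- The thin representation with support `P`: it has one-dimensional spaces at the vertices in `P`,
with identities between them, and is zero elsewhere. -/
def thin (k : Type u) [Field k] {V : Type v} (Q : Quiver.{w} V) (P : V → Prop) : QuiverRep k Q where
  space x := PLift (P x) → k
  map {x y} _ := thinHom (P x) (P y)

open Classical in
theorem dimVec_thin (P : V → Prop) (x : V) :
    (thin k Q P).dimVec x = if P x then 1 else 0 := by
  change ((Module.finrank k (PLift (P x) → k) : ℕ) : ℝ) = _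
  rw [Module.finrank_fintype_fun_eq_card]
  split_ifs with h
  · simp [h]
  · simp [h]

theorem nontrivial_thin_iff (P : V → Prop) (x : V) :
    Nontrivial ((thin k Q P).space x) ↔ P x := by
  change Nontrivial (PLift (P x) → k) ↔ P x
  constructor
  · intro h
    by_contra hP
    obtain ⟨a, b, hab⟩ := h
    exact hab (funext fun j => (hP j.down).elim)
  · intro h
    have : Nonempty (PLift (P x)) := ⟨⟨h⟩⟩
    infer_instance

theorem Isomorphic.dimVec_eq {M N : QuiverRep k Q} (h : M.Isomorphic N) : M.dimVec = N.dimVec := by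
  obtain ⟨e, -⟩ := h
  funext x
  rw [dimVec, dimVec, (e x).finrank_eq]

theorem isZero_iff (M : QuiverRep k Q) : M.IsZero ↔ ∀ x, Module.finrank k (M.space x) = 0 :=
  forall_congr' fun _ => Module.finrank_zero_iff.symm

/-- In a decomposition the two dimensions add up to one on the interval. The arrows inside the
interval act injectively on both summands, so neither dimension drops along an arrow, and both are
constant on the interval. -/
theorem indecomposable_thin (hQ : IsLinear Q o pos) {r s : ℕ} (hrs : r ≤ s)
    (hmem : ∀ i, r ≤ i → i ≤ s → i ∈ Set.range pos) :
    (thin k Q fun x => r ≤ pos x ∧ pos x ≤ s).Indecomposable := by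
  set M := thin k Q fun x => r ≤ pos x ∧ pos x ≤ s with hM
  obtain ⟨x₀, hx₀⟩ := hmem r le_rfl hrs
  refine ⟨fun h => ?_, ?_⟩
  · have h1 := (nontrivial_thin_iff (k := k) (Q := Q) (fun x => r ≤ pos x ∧ pos x ≤ s) x₀).2
      ⟨hx₀.ge, hx₀.le.trans hrs⟩
    have := h x₀
    exact false_of_nontrivial_of_subsingleton (M.space x₀)
  · rintro A B ⟨e, he⟩
    have hdim : ∀ x, Module.finrank k (A.space x) + Module.finrank k (B.space x) =
        if r ≤ pos x ∧ pos x ≤ s then 1 else 0 := by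
      intro x
      have h1 := (e x).finrank_eq
      have h2 : Module.finrank k ((A.prod B).space x) = _ :=
        Module.finrank_prod (R := k) (M := A.space x) (M' := B.space x)
      have h3 := dimVec_thin (k := k) (Q := Q) (fun x => r ≤ pos x ∧ pos x ≤ s) x
      rw [dimVec, ← hM, h1, h2] at h3
      split_ifs at h3 ⊢ with h
      · exact_mod_cast h3
      · exact_mod_cast h3
    have hinj : ∀ (x y : V) (a : @Quiver.Hom V Q x y), (r ≤ pos y ∧ pos y ≤ s) →
        Module.finrank k (A.space x) ≤ Module.finrank k (A.space y) ∧
        Module.finrank k (B.space x) ≤ Module.finrank k (B.space y) := by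
      intro x y a hy
      have h1 : Function.Injective ((A.prod B).map a) := by
        intro m m' hmm
        obtain ⟨n, rfl⟩ := (e x).surjective m
        obtain ⟨n', rfl⟩ := (e x).surjective m'
        rw [← he, ← he] at hmm
        exact congrArg (e x) (thinHom_injective hy ((e y).injective hmm))
      constructor
      · refine LinearMap.finrank_le_finrank_of_injective (f := A.map a) fun m m' hmm => ?_
        exact congrArg Prod.fst (@h1 (m, 0) (m', 0) (Prod.ext hmm rfl))
      · refine LinearMap.finrank_le_finrank_of_injective (f := B.map a) fun m m' hmm => ?_
        exact congrArg Prod.snd (@h1 (0, m) (0, m') (Prod.ext rfl hmm))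
    have hconst : ∀ i, r ≤ i → i ≤ s → ∀ x, pos x = i →
        Module.finrank k (A.space x) = Module.finrank k (A.space x₀) := by
      intro i hi
      induction i, hi using Nat.le_induction with
      | base =>
        intro _ x hx
        rw [hQ.injective (hx.trans hx₀.symm)]
      | succ i hi ih =>
        intro his y hy
        obtain ⟨x, hx⟩ := hmem i hi (by omega)
        rw [← ih (by omega) x hx]
        have hdx := hdim x
        have hdy := hdim y
        rw [if_pos (by omega)] at hdx hdy
        cases ho : o i
        · obtain ⟨a⟩ := (hQ.nonempty_iff y x).2 (Or.inr ⟨by omega, by rw [hx, ho]⟩)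
          have := hinj y x a (by omega)
          omega
        · obtain ⟨a⟩ := (hQ.nonempty_iff x y).2 (Or.inl ⟨by omega, by rw [hx, ho]⟩)
          have := hinj x y a (by omega)
          omega
    have hx₀d := hdim x₀
    rw [if_pos (by omega)] at hx₀d
    rw [isZero_iff, isZero_iff]
    by_cases h0 : Module.finrank k (A.space x₀) = 0
    · refine Or.inl fun x => ?_
      by_cases hx : r ≤ pos x ∧ pos x ≤ s
      · rw [hconst _ hx.1 hx.2 x rfl, h0]
      · have := hdim x
        rw [if_neg hx] at this
        omega
    · refine Or.inr fun x => ?_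
      have := hdim x
      by_cases hx : r ≤ pos x ∧ pos x ≤ s
      · rw [if_pos hx, hconst _ hx.1 hx.2 x rfl] at this
        omega
      · rw [if_neg hx] at this
        omega

-- Maps between thin representations are scalars, so surjectivity of `extMap` is a linear system
-- with one equation per edge, in the scalars at its two ends. The first alternative makes the
-- coefficient of the left end `±1` in every relevant equation, so the system is solved from right
-- to left; the second alternative does the same for the right end.
open Classical in
theorem extMap_thin_surjective (hQ : IsLinear Q o pos) {n : ℕ} (hn : ∀ x, pos x < n)
    {P R : ℕ → Prop}
    (h : (∀ i, (o i = true → P i → R (i + 1) → R i) ∧ (o i = false → P (i + 1) → R i → P i)) ∨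
      (∀ i, (o i = true → P i → R (i + 1) → P (i + 1)) ∧
        (o i = false → P (i + 1) → R i → R (i + 1)))) :
    Function.Surjective (extMap (thin k Q fun x => P (pos x)) (thin k Q fun x => R (pos x))) := by
  intro φ
  have hc : ∀ (x y : V) (a : @Quiver.Hom V Q x y), ∃ c : k,
      φ x y a = c • thinHom (k := k) (P (pos x)) (R (pos y)) := fun x y a =>
    eq_smul_thinHom (k := k) (p := P (pos x)) (q := R (pos y)) (φ x y a)
  choose c hc using hc
  -- The equation on the edge between `i` and `i + 1` in the unknown scalars `s` at `i` and `t` at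
  -- `i + 1`. It counts only if source and target of the component are both nonzero.
  let E : ℕ → k → k → Prop := fun i s t =>
    (∀ (x y : V) (a : @Quiver.Hom V Q x y), pos x = i → pos y = i + 1 → P i → R (i + 1) →
      (if R i then 1 else 0) * s - (if P (i + 1) then 1 else 0) * t = c x y a) ∧
    (∀ (x y : V) (a : @Quiver.Hom V Q x y), pos x = i + 1 → pos y = i → P (i + 1) → R i →
      (if R (i + 1) then 1 else 0) * t - (if P i then 1 else 0) * s = c x y a)
  have hE : ∃ s : ℕ → k, ∀ i < n, E i (s i) (s (i + 1)) := by
    have huniq : ∀ (x y x' y' : V) (a : @Quiver.Hom V Q x y) (b : @Quiver.Hom V Q x' y'),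
        pos x = pos x' → pos y = pos y' → c x' y' b = c x y a := by
      intro x y x' y' a b h1 h2
      obtain rfl := hQ.injective h1
      obtain rfl := hQ.injective h2
      rw [(hQ.subsingleton x y).elim a b]
    have hout : ∀ (x y : V) (a : @Quiver.Hom V Q x y), pos y = pos x + 1 → o (pos x) = true := by
      intro x y a h1
      rcases (hQ.nonempty_iff x y).1 ⟨a⟩ with h | h
      · exact h.2
      · omega
    have hin : ∀ (x y : V) (a : @Quiver.Hom V Q x y), pos x = pos y + 1 → o (pos y) = false := by
      intro x y a h1
      rcases (hQ.nonempty_iff x y).1 ⟨a⟩ with h | h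
      · omega
      · exact h.2
    have hempty : ∀ (x y x' y' : V) (a : @Quiver.Hom V Q x y) (b : @Quiver.Hom V Q x' y'),
        pos x = pos y' → pos y = pos x' → False := by
      intro x y x' y' a b h1 h2
      obtain rfl := hQ.injective h1
      obtain rfl := hQ.injective h2
      exact (hQ.isEmpty_symm a).false b
    rcases h with h | h
    · refine exists_seq_backward (fun i t => ?_) n
      by_cases h1 : ∃ (x y : V) (_ : @Quiver.Hom V Q x y), pos x = i ∧ pos y = i + 1
      · obtain ⟨x, y, a, rfl, hy⟩ := h1
        refine ⟨c x y a + (if P (pos x + 1) then 1 else 0) * t, fun x' y' b hx' hy' hP hR => ?_,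
          fun x' y' b hx' hy' _ _ => (hempty x y x' y' a b hy'.symm (hy.trans hx'.symm)).elim⟩
        rw [if_pos ((h _).1 (hout x y a hy) hP hR),
          huniq x y x' y' a b hx'.symm (hy.trans hy'.symm)]
        ring
      · by_cases h2 : ∃ (x y : V) (_ : @Quiver.Hom V Q x y), pos x = i + 1 ∧ pos y = i
        · obtain ⟨x, y, a, hx, rfl⟩ := h2
          refine ⟨(if R (pos y + 1) then 1 else 0) * t - c x y a,
            fun x' y' b hx' hy' _ _ => (h1 ⟨x', y', b, hx', hy'⟩).elim,
            fun x' y' b hx' hy' hP hR => ?_⟩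
          rw [if_pos (c := P (pos y)) ((h _).2 (hin x y a hx) hP hR),
            huniq x y x' y' a b (hx.trans hx'.symm) hy'.symm]
          ring
        · exact ⟨0, fun x' y' b hx' hy' _ _ => (h1 ⟨x', y', b, hx', hy'⟩).elim,
            fun x' y' b hx' hy' _ _ => (h2 ⟨x', y', b, hx', hy'⟩).elim⟩
    · suffices hE : ∀ i t, ∃ s, E i t s by
        obtain ⟨s, hs⟩ := exists_seq_forward hE
        exact ⟨s, fun i _ => hs i⟩
      intro i t
      by_cases h1 : ∃ (x y : V) (_ : @Quiver.Hom V Q x y), pos x = i ∧ pos y = i + 1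
      · obtain ⟨x, y, a, rfl, hy⟩ := h1
        refine ⟨(if R (pos x) then 1 else 0) * t - c x y a, fun x' y' b hx' hy' hP hR => ?_,
          fun x' y' b hx' hy' _ _ => (hempty x y x' y' a b hy'.symm (hy.trans hx'.symm)).elim⟩
        rw [if_pos (c := P (pos x + 1)) ((h _).1 (hout x y a hy) hP hR),
          huniq x y x' y' a b hx'.symm (hy.trans hy'.symm)]
        ring
      · by_cases h2 : ∃ (x y : V) (_ : @Quiver.Hom V Q x y), pos x = i + 1 ∧ pos y = i
        · obtain ⟨x, y, a, hx, rfl⟩ := h2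
          refine ⟨(if P (pos y) then 1 else 0) * t + c x y a,
            fun x' y' b hx' hy' _ _ => (h1 ⟨x', y', b, hx', hy'⟩).elim,
            fun x' y' b hx' hy' hP hR => ?_⟩
          rw [if_pos (c := R (pos y + 1)) ((h _).2 (hin x y a hx) hP hR),
            huniq x y x' y' a b (hx.trans hx'.symm) hy'.symm]
          ring
        · exact ⟨0, fun x' y' b hx' hy' _ _ => (h1 ⟨x', y', b, hx', hy'⟩).elim,
            fun x' y' b hx' hy' _ _ => (h2 ⟨x', y', b, hx', hy'⟩).elim⟩
  obtain ⟨s, hs⟩ := hE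
  refine ⟨fun x => s (pos x) • thinHom (k := k) (P (pos x)) (R (pos x)), ?_⟩
  funext x y a
  refine LinearMap.ext fun (m : PLift (P (pos x)) → k) => ?_
  suffices key : thinHom (R (pos x)) (R (pos y)) (s (pos x) • thinHom (P (pos x)) (R (pos x)) m) -
      s (pos y) • thinHom (P (pos y)) (R (pos y)) (thinHom (P (pos x)) (P (pos y)) m) =
      (c x y a • thinHom (k := k) (P (pos x)) (R (pos y))) m by
    exact key.trans (congrArg (fun g => g m) (hc x y a).symm)
  rw [map_smul, thinHom_comp, thinHom_comp, smul_smul, smul_smul, ← sub_smul]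
  by_cases hPR : P (pos x) ∧ R (pos y)
  · rw [LinearMap.smul_apply]
    congr 1
    rw [mul_comm, mul_comm (s (pos y))]
    rcases hQ.pos_eq a with h1 | h1
    · have := (hs (pos x) (hn x)).1 x y a rfl h1.symm hPR.1 (h1 ▸ hPR.2)
      rwa [h1] at this
    · have := (hs (pos y) (hn y)).2 x y a h1.symm rfl (h1 ▸ hPR.1) hPR.2
      rwa [h1] at this
  · rw [thinHom_eq_zero hPR]
    simp

/-- The thin representation supported on the vertices at the positions `b.1, …, b.2`. -/
abbrev intervalRep (k : Type u) [Field k] {V : Type v} (Q : Quiver.{w} V) (pos : V → ℕ)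
    (b : ℕ × ℕ) : QuiverRep k Q :=
  thin k Q fun x => b.1 ≤ pos x ∧ pos x ≤ b.2

theorem isTilting_intervalRep (hQ : IsLinear Q o pos) {A : Finset ℕ} (hA : (A : Set ℕ) = Set.range pos)
    {C : Finset (ℕ × ℕ)} (hC : IsTiltingSet o A C) {m : ℕ} (e : Fin m ≃ C) :
    IsTilting fun i => intervalRep k Q pos (e i) where
  card_eq := by
    rw [← Nat.card_range_of_injective hQ.injective, ← hA]
    have := Nat.card_congr e
    simp only [Nat.card_eq_fintype_card, Fintype.card_fin, Fintype.card_coe] at this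
    rw [this, hC.card]
    simp
  indecomposable i := by
    obtain ⟨h1, h2⟩ := hC.interval _ (e i).2
    refine indecomposable_thin hQ h1 fun j hj hj' => ?_
    rw [← hA]
    exact h2 j hj hj'
  pairwise_not_isomorphic i j hij h := by
    refine hij (e.injective (Subtype.ext ?_))
    obtain ⟨h1, h2⟩ := hC.interval _ (e i).2
    obtain ⟨h3, h4⟩ := hC.interval _ (e j).2
    have hd : ∀ p ∈ A, ((e i).1.1 ≤ p ∧ p ≤ (e i).1.2 ↔ (e j).1.1 ≤ p ∧ p ≤ (e j).1.2) := by
      intro p hp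
      obtain ⟨x, rfl⟩ : p ∈ Set.range pos := by rw [← hA]; exact hp
      have := congrFun h.dimVec_eq x
      rw [dimVec_thin, dimVec_thin] at this
      split_ifs at this with ha hb hb
      · exact iff_of_true ha hb
      · exact (one_ne_zero this).elim
      · exact (zero_ne_one this).elim
      · exact iff_of_false ha hb
    have e1 := hd _ (h2 _ le_rfl h1)
    have e2 := hd _ (h2 _ h1 le_rfl)
    have e3 := hd _ (h4 _ le_rfl h3)
    have e4 := hd _ (h4 _ h3 le_rfl)
    ext <;> omega
  rigid := by
    rw [subsingleton_ext1_directSum_iff]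
    intro i j
    obtain ⟨n, hn⟩ : ∃ n, ∀ x, pos x < n :=
      ⟨A.sup id + 1, fun x => Nat.lt_succ_of_le (Finset.le_sup (f := id)
        (by rw [← Finset.mem_coe, hA]; exact ⟨x, rfl⟩))⟩
    refine extMap_thin_surjective hQ hn (P := fun p => (e i).1.1 ≤ p ∧ p ≤ (e i).1.2)
      (R := fun p => (e j).1.1 ≤ p ∧ p ≤ (e j).1.2) ?_
    have h1 := hC.compat _ (e i).2 _ (e j).2
    have h2 := hC.compat _ (e j).2 _ (e i).2
    generalize (e i).1 = b at h1 h2 ⊢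
    generalize (e j).1 = c at h1 h2 ⊢
    obtain ⟨a, b⟩ := b
    obtain ⟨c, d⟩ := c
    simp only at h1 h2 ⊢
    -- The order of the left ends decides the direction of solving. One order rules out an
    -- obstruction at a left end; in the other, compatibility rules out an obstruction at a right
    -- end.
    rcases le_or_gt (leftRank o c) (leftRank o a) with hr | hr
    · refine Or.inl fun p => ⟨fun ho ha hc => ?_, fun ho ha hc => ?_⟩
      · by_contra hp
        obtain rfl : c = p + 1 := by omega
        exact hr.not_gt (leftRank_lt (by omega) ho)
      · by_contra hp
        obtain rfl : a = p + 1 := by omega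
        exact hr.not_gt (lt_leftRank (by omega) ho)
    · refine Or.inr fun p => ⟨fun ho ha hc => ?_, fun ho ha hc => ?_⟩
      · by_contra hp
        obtain rfl : p = b := by omega
        exact hr.not_ge ((h1 (by omega) (by omega)).2.1 ho)
      · by_contra hp
        obtain rfl : p = d := by omega
        exact hr.not_ge ((h2 (by omega) (by omega)).2.2 ho)

theorem isSupportTilting_of_restrict {m : ℕ} {T : Fin m → QuiverRep k Q} {S : Set V}
    (hS : supp T = S) (h : IsTilting fun i => (T i).restrict S) : IsSupportTilting T := by
  subst hS
  exact h

end QuiverRep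

/-! ### The polytopes as sublevel sets of the gauge -/

theorem mem_convexHull_insert_zero_range {ι E : Type*} [Fintype ι] [AddCommGroup E] [Module ℝ E]
    {f : ι → E} {p : E} :
    p ∈ convexHull ℝ (insert 0 (Set.range f)) ↔
      ∃ w : ι → ℝ, (∀ i, 0 ≤ w i) ∧ ∑ i, w i ≤ 1 ∧ p = ∑ i, w i • f i := by
  classical
  constructor
  · intro hp
    refine convexHull_min (t := {p | ∃ w : ι → ℝ, (∀ i, 0 ≤ w i) ∧ ∑ i, w i ≤ 1 ∧
      p = ∑ i, w i • f i}) ?_ ?_ hp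
    · rintro _ (rfl | ⟨i, rfl⟩)
      · exact ⟨0, by simp, by simp, by simp⟩
      · exact ⟨Pi.single i 1, fun j => by
          by_cases h : j = i
          · subst h; simp
          · simp [h], by simp, by simp [Pi.single_apply, ite_smul]⟩
    · rintro _ ⟨w, hw0, hw1, rfl⟩ _ ⟨w', hw0', hw1', rfl⟩ a b ha hb hab
      refine ⟨fun i => a * w i + b * w' i, fun i => ?_, ?_, ?_⟩
      · exact add_nonneg (mul_nonneg ha (hw0 i)) (mul_nonneg hb (hw0' i))
      · rw [Finset.sum_add_distrib, ← Finset.mul_sum, ← Finset.mul_sum, ← hab]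
        exact add_le_add (mul_le_of_le_one_right ha hw1) (mul_le_of_le_one_right hb hw1')
      · simp only [add_smul, Finset.sum_add_distrib, Finset.smul_sum, smul_smul]
  · rintro ⟨w, hw0, hw1, rfl⟩
    refine mem_convexHull_of_exists_fintype (ι := Option ι)
      (fun i => i.elim (1 - ∑ i, w i) w) (fun i => i.elim 0 f) ?_ ?_ ?_ ?_
    · rintro (_ | i)
      · simpa using hw1
      · exact hw0 i
    · simp [Fintype.sum_option]
    · rintro (_ | i)
      · exact Set.mem_insert _ _
      · exact Set.mem_insert_of_mem _ ⟨i, rfl⟩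
    · simp [Fintype.sum_option]

/-- The number of jumps of a sequence of dimensions: the number of intervals of a generic
representation of a linear quiver with these dimensions at the first `n` positions. -/
def seqGauge (n : ℕ) (D : ℕ → ℝ) : ℝ := ∑ i ∈ Finset.range n, (D i - min (D i) (D (i + 1)))

section toSeq

variable {V : Type v} {pos : V → ℕ}

/-- The sequence with entry `d x` at the position of `x`, and zero at the other positions. -/
def toSeq (pos : V → ℕ) (d : V → ℝ) : ℕ → ℝ := Function.extend pos d 0

theorem toSeq_pos (hpos : Function.Injective pos) (d : V → ℝ) (x : V) :
    toSeq pos d (pos x) = d x := hpos.extend_apply _ _ _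

theorem toSeq_of_notMem (d : V → ℝ) {i : ℕ} (h : i ∉ Set.range pos) : toSeq pos d i = 0 :=
  Function.extend_apply' _ _ _ h

theorem toSeq_subtype (hpos : Function.Injective pos) (S : Set V) (d : V → ℝ)
    (hd : ∀ x ∉ S, d x = 0) :
    toSeq (fun x : S => pos x) (fun x => d x) = toSeq pos d := by
  have hinj : Function.Injective fun x : S => pos x := hpos.comp Subtype.val_injective
  funext i
  by_cases h : i ∈ Set.range pos
  · obtain ⟨x, rfl⟩ := h
    rw [toSeq_pos hpos]
    by_cases hx : x ∈ S
    · exact toSeq_pos hinj (fun x : S => d x) ⟨x, hx⟩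
    · rw [hd x hx, toSeq_of_notMem]
      rintro ⟨y, hy⟩
      exact hx (hpos hy ▸ y.2)
  · rw [toSeq_of_notMem d h, toSeq_of_notMem]
    rintro ⟨y, rfl⟩
    exact h ⟨y, rfl⟩

theorem toSeq_sum_smul (hpos : Function.Injective pos) {ι : Type*} [Fintype ι] (c : ι → ℝ)
    (d : ι → V → ℝ) (i : ℕ) :
    toSeq pos (∑ l, c l • d l) i = ∑ l, c l * toSeq pos (d l) i := by
  by_cases h : i ∈ Set.range pos
  · obtain ⟨x, rfl⟩ := h
    simp [toSeq_pos hpos]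
  · simp [toSeq_of_notMem _ h]

end toSeq

theorem min_sum_mul {ι : Type*} [Fintype ι] {c f g : ι → ℝ} (hc : ∀ i, 0 ≤ c i)
    (h : (∀ i, f i ≤ g i) ∨ ∀ i, g i ≤ f i) :
    min (∑ i, c i * f i) (∑ i, c i * g i) = ∑ i, c i * min (f i) (g i) := by
  rcases h with h | h
  · rw [min_eq_left (Finset.sum_le_sum fun i _ => mul_le_mul_of_nonneg_left (h i) (hc i))]
    exact Finset.sum_congr rfl fun i _ => by rw [min_eq_left (h i)]
  · rw [min_eq_right (Finset.sum_le_sum fun i _ => mul_le_mul_of_nonneg_left (h i) (hc i))]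
    exact Finset.sum_congr rfl fun i _ => by rw [min_eq_right (h i)]

theorem seqGauge_interval {n r s : ℕ} (hrs : r ≤ s) (hs : s < n) :
    seqGauge n (fun i => if r ≤ i ∧ i ≤ s then 1 else 0) = 1 := by
  rw [seqGauge, Finset.sum_eq_single s]
  · rw [if_pos ⟨hrs, le_rfl⟩, if_neg (by omega)]
    norm_num
  · intro i _ hi
    by_cases h : r ≤ i ∧ i ≤ s
    · rw [if_pos h, if_pos (by omega)]
      norm_num
    · rw [if_neg h]
      split_ifs <;> norm_num
  · intro h
    exact (h (Finset.mem_range.2 hs)).elim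

namespace QuiverRep

variable {k : Type u} [Field k] {V : Type v} {Q : Quiver.{w} V} {o : ℕ → Bool} {pos : V → ℕ}
  {n m : ℕ} {T : Fin m → QuiverRep k Q}

theorem dimVec_nonneg (M : QuiverRep k Q) (x : V) : 0 ≤ M.dimVec x := Nat.cast_nonneg _

/-- If one summand is not injective at the arrow, the vanishing of its extensions with every summand
forces all of them to be surjective there. -/
theorem dimVec_le_or_le_of_rigid
    (hT : Subsingleton (Ext1 (directSum T) (directSum T))) {x y : V} (a : @Quiver.Hom V Q x y) :
    (∀ i, (T i).dimVec x ≤ (T i).dimVec y) ∨ ∀ i, (T i).dimVec y ≤ (T i).dimVec x := by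
  rw [subsingleton_ext1_directSum_iff] at hT
  by_cases h : ∀ i, Function.Injective ((T i).map a)
  · exact Or.inl fun i => Nat.cast_le.2 (LinearMap.finrank_le_finrank_of_injective (h i))
  · push Not at h
    obtain ⟨i, hi⟩ := h
    exact Or.inr fun j => Nat.cast_le.2 (LinearMap.finrank_le_finrank_of_surjective
      ((injective_or_surjective_of_extMap_surjective (hT i j) a).resolve_left hi))

/-- Neighbouring dimensions compare in the same way for all summands, so the minima in the gauge are
additive on the cone of `T`; each summand is an interval and has exactly one drop. -/
theorem IsTilting.seqGauge_eq (hQ : IsLinear Q o pos) (hn : ∀ x, pos x < n) (hT : IsTilting T)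
    {c : Fin m → ℝ} (hc : ∀ i, 0 ≤ c i) :
    seqGauge n (toSeq pos (∑ i, c i • (T i).dimVec)) = ∑ i, c i := by
  choose r s hrs hsn hmem hdim using fun i => (hT.indecomposable i).exists_interval hQ hn
  have hD : ∀ i, toSeq pos (T i).dimVec = fun j => if r i ≤ j ∧ j ≤ s i then 1 else 0 := by
    intro i
    funext j
    by_cases h : j ∈ Set.range pos
    · obtain ⟨x, rfl⟩ := h
      rw [toSeq_pos hQ.injective, hdim]
    · rw [toSeq_of_notMem _ h, if_neg fun h' => h (hmem i j h'.1 h'.2)]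
  have hnn : ∀ i j, 0 ≤ toSeq pos (T i).dimVec j := by
    intro i j
    rw [hD]
    simp only
    split_ifs <;> norm_num
  have hcomp : ∀ j, (∀ i, toSeq pos (T i).dimVec j ≤ toSeq pos (T i).dimVec (j + 1)) ∨
      ∀ i, toSeq pos (T i).dimVec (j + 1) ≤ toSeq pos (T i).dimVec j := by
    intro j
    by_cases h : j ∈ Set.range pos
    · by_cases h' : j + 1 ∈ Set.range pos
      · obtain ⟨x, rfl⟩ := h
        obtain ⟨y, hy⟩ := h'
        rw [← hy]
        simp only [toSeq_pos hQ.injective]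
        cases ho : o (pos x)
        · obtain ⟨a⟩ := (hQ.nonempty_iff y x).2 (Or.inr ⟨hy.symm, ho⟩)
          exact (dimVec_le_or_le_of_rigid hT.rigid a).symm
        · obtain ⟨a⟩ := (hQ.nonempty_iff x y).2 (Or.inl ⟨hy.symm, ho⟩)
          exact dimVec_le_or_le_of_rigid hT.rigid a
      · exact Or.inr fun i => (toSeq_of_notMem _ h').le.trans (hnn i j)
    · exact Or.inl fun i => (toSeq_of_notMem _ h).le.trans (hnn i (j + 1))
  have h1 : seqGauge n (toSeq pos (∑ i, c i • (T i).dimVec)) =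
      ∑ i, c i * seqGauge n (toSeq pos (T i).dimVec) := by
    simp only [seqGauge, Finset.mul_sum]
    rw [Finset.sum_comm]
    refine Finset.sum_congr rfl fun j _ => ?_
    rw [toSeq_sum_smul hQ.injective, toSeq_sum_smul hQ.injective, min_sum_mul hc (hcomp j),
      ← Finset.sum_sub_distrib]
    exact Finset.sum_congr rfl fun i _ => (mul_sub _ _ _).symm
  rw [h1]
  refine Finset.sum_congr rfl fun i _ => ?_
  rw [hD, seqGauge_interval (hrs i) (hsn i), mul_one]

theorem dimVec_eq_zero_of_notMem_supp {x : V} (hx : x ∉ supp T) (i : Fin m) :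
    (T i).dimVec x = 0 := by
  have : Subsingleton ((T i).space x) := not_nontrivial_iff_subsingleton.1 fun h => hx ⟨i, h⟩
  rw [dimVec, Module.finrank_zero_of_subsingleton, Nat.cast_zero]

theorem sum_smul_dimVec_eq_zero {x : V} (hx : x ∉ supp T) (c : Fin m → ℝ) :
    (∑ i, c i • (T i).dimVec) x = 0 := by
  rw [Finset.sum_apply]
  exact Finset.sum_eq_zero fun i _ => by
    rw [Pi.smul_apply, dimVec_eq_zero_of_notMem_supp hx, smul_zero]

theorem sum_smul_dimVec_nonneg {c : Fin m → ℝ} (hc : ∀ i, 0 ≤ c i) (x : V) :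
    0 ≤ (∑ i, c i • (T i).dimVec) x := by
  rw [Finset.sum_apply]
  exact Finset.sum_nonneg fun i _ => mul_nonneg (hc i) (dimVec_nonneg _ _)

theorem IsSupportTilting.seqGauge_eq (hQ : IsLinear Q o pos) (hn : ∀ x, pos x < n)
    (hT : IsSupportTilting T) {c : Fin m → ℝ} (hc : ∀ i, 0 ≤ c i) :
    seqGauge n (toSeq pos (∑ i, c i • (T i).dimVec)) = ∑ i, c i := by
  rw [← IsTilting.seqGauge_eq (hQ.fullSubquiver (supp T)) (fun x => hn x) hT hc,
    ← toSeq_subtype hQ.injective (supp T) _ fun x hx => sum_smul_dimVec_eq_zero hx c]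
  congr 2
  funext x
  simp only [Finset.sum_apply]
  rfl

/-- The set `S` may be larger than the support of `d`. This freedom lets the zero coordinates be
assigned to either side of a 2-support tilting module. -/
theorem exists_isTiltingSet_sum_eq (hQ : IsLinear Q o pos) [Finite V] (S : Set V) (d : V → ℝ)
    (hd : ∀ x, 0 ≤ d x) (hdS : ∀ x ∉ S, d x = 0) :
    ∃ A : Finset ℕ, (A : Set ℕ) = pos '' S ∧ ∃ C, IsTiltingSet o A C ∧ ∃ (m : ℕ) (e : Fin m ≃ C),
      supp (fun i => intervalRep k Q pos (e i)) = S ∧ ∃ c : Fin m → ℝ, (∀ i, 0 ≤ c i) ∧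
        d = ∑ i, c i • (intervalRep k Q pos (e i)).dimVec := by
  obtain ⟨A, hA⟩ := (Set.toFinite (pos '' S)).exists_finset_coe
  have hmem : ∀ x, pos x ∈ A ↔ x ∈ S := fun x => by
    rw [← Finset.mem_coe, hA, hQ.injective.mem_set_image]
  obtain ⟨C, hC, w, hw, hsum⟩ := exists_isTiltingSet o A (toSeq pos d) (fun i => by
    by_cases h : i ∈ Set.range pos
    · obtain ⟨x, rfl⟩ := h
      rw [toSeq_pos hQ.injective]
      exact hd x
    · rw [toSeq_of_notMem _ h]) (fun i hi => by
    by_cases h : i ∈ Set.range pos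
    · obtain ⟨x, rfl⟩ := h
      rw [toSeq_pos hQ.injective, hdS x fun hx => hi ((hmem x).2 hx)]
    · rw [toSeq_of_notMem _ h])
  refine ⟨A, hA, C, hC, Fintype.card C, (Fintype.equivFin C).symm, ?_,
    fun i => w ((Fintype.equivFin C).symm i), fun i => hw _, ?_⟩
  · ext x
    rw [← hmem]
    constructor
    · rintro ⟨i, hi⟩
      rw [nontrivial_thin_iff] at hi
      exact (hC.interval _ (Subtype.prop _)).2 _ hi.1 hi.2
    · intro hx
      obtain ⟨b, hb, hbx⟩ := hC.cover _ hx
      refine ⟨Fintype.equivFin C ⟨b, hb⟩, ?_⟩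
      rw [nontrivial_thin_iff, Equiv.symm_apply_apply]
      exact hbx
  · funext x
    rw [← toSeq_pos hQ.injective d x, hsum, ← Finset.sum_coe_sort C, Finset.sum_apply,
      ← (Fintype.equivFin C).symm.sum_comp]
    refine Finset.sum_congr rfl fun i _ => ?_
    rw [Pi.smul_apply, dimVec_thin, smul_eq_mul, mul_ite, mul_one, mul_zero]
    congr

theorem exists_isSupportTilting (k : Type u) [Field k] (hQ : IsLinear Q o pos) [Finite V]
    (S : Set V) (d : V → ℝ) (hd : ∀ x, 0 ≤ d x) (hdS : ∀ x ∉ S, d x = 0) :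
    ∃ (m : ℕ) (T : Fin m → QuiverRep k Q), IsSupportTilting T ∧ supp T = S ∧
      ∃ c : Fin m → ℝ, (∀ i, 0 ≤ c i) ∧ d = ∑ i, c i • (T i).dimVec := by
  obtain ⟨A, hA, C, hC, m, e, hsupp, c, hc, hsum⟩ :=
    exists_isTiltingSet_sum_eq (k := k) hQ S d hd hdS
  refine ⟨m, _, isSupportTilting_of_restrict hsupp ?_, hsupp, c, hc, hsum⟩
  refine isTilting_intervalRep (hQ.fullSubquiver S) ?_ hC e
  rw [hA, Set.image_eq_range]

theorem PPlus_eq (k : Type u) [Field k] (hQ : IsLinear Q o pos) [Finite V]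
    (hn : ∀ x, pos x < n) :
    PPlus k Q = {p | (∀ x, 0 ≤ p x) ∧ seqGauge n (toSeq pos p) ≤ 1} := by
  ext p
  constructor
  · rintro ⟨m, T, hT, hp⟩
    obtain ⟨c, hc, hc1, rfl⟩ := mem_convexHull_insert_zero_range.1 hp
    exact ⟨sum_smul_dimVec_nonneg hc, (hT.seqGauge_eq hQ hn hc).trans_le hc1⟩
  · rintro ⟨hp, hp1⟩
    obtain ⟨A, hA, C, hC, m, e, -, c, hc, rfl⟩ :=
      exists_isTiltingSet_sum_eq (k := k) hQ Set.univ p hp (fun x hx => (hx trivial).elim)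
    have hT := isTilting_intervalRep (k := k) hQ (by rw [hA, Set.image_univ]) hC e
    refine ⟨m, _, hT, mem_convexHull_insert_zero_range.2 ⟨c, hc, ?_, rfl⟩⟩
    rwa [hT.seqGauge_eq hQ hn hc] at hp1

theorem posPart_eq_of_sub {p a b : V → ℝ} (hp : p = a - b) (ha : ∀ x, 0 ≤ a x) (hb : ∀ x, 0 ≤ b x)
    (hab : ∀ x, a x = 0 ∨ b x = 0) : p ⊔ 0 = a ∧ -p ⊔ 0 = b := by
  subst hp
  constructor
  · funext x
    have h1 := ha x
    have h2 := hb x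
    simp only [Pi.sup_apply, Pi.sub_apply, Pi.zero_apply]
    rcases hab x with h | h
    · rw [h, zero_sub, sup_eq_right]; linarith
    · rw [h, sub_zero, sup_eq_left]; exact h1
  · funext x
    have h1 := ha x
    have h2 := hb x
    simp only [Pi.sup_apply, Pi.sub_apply, Pi.zero_apply, Pi.neg_apply]
    rcases hab x with h | h
    · rw [h, zero_sub, neg_neg, sup_eq_left]; exact h2
    · rw [h, sub_zero, sup_eq_right]; linarith

theorem sup_sub_neg_sup (p : V → ℝ) : p = p ⊔ 0 - (-p ⊔ 0) := by
  funext x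
  simp only [Pi.sup_apply, Pi.sub_apply, Pi.zero_apply, Pi.neg_apply]
  rcases le_total (p x) 0 with h | h
  · rw [sup_eq_right.2 h, sup_eq_left.2 (by linarith)]; ring
  · rw [sup_eq_left.2 h, sup_eq_right.2 (by linarith)]; ring

/-- The disjoint supports of `T⁺` and `T⁻` make their contributions the positive and the negative
part of `p`, so the total weight is the sum of the two gauges. -/
theorem PFull_eq (k : Type u) [Field k] (hQ : IsLinear Q o pos) [Finite V]
    (hn : ∀ x, pos x < n) :
    PFull k Q =
      {p | seqGauge n (toSeq pos (p ⊔ 0)) + seqGauge n (toSeq pos (-p ⊔ 0)) ≤ 1} := by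
  ext p
  constructor
  · rintro ⟨m, l, Tp, Tm, hTp, hTm, hS, hp⟩
    rw [← Set.Sum.elim_range, mem_convexHull_insert_zero_range] at hp
    obtain ⟨c, hc, hc1, hp⟩ := hp
    rw [Fintype.sum_sum_type] at hc1 hp
    simp only [Sum.elim_inl, Sum.elim_inr, smul_neg, Finset.sum_neg_distrib,
      ← sub_eq_add_neg] at hp
    obtain ⟨h1, h2⟩ := posPart_eq_of_sub hp (sum_smul_dimVec_nonneg fun i => hc _)
      (sum_smul_dimVec_nonneg fun i => hc _) fun x => by
        by_cases hx : x ∈ supp Tp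
        · exact Or.inr (sum_smul_dimVec_eq_zero (fun hx' => Set.disjoint_left.1 hS.1 hx hx') _)
        · exact Or.inl (sum_smul_dimVec_eq_zero hx _)
    rw [Set.mem_ofPred_eq, h1, h2, hTp.seqGauge_eq hQ hn fun i => hc _,
      hTm.seqGauge_eq hQ hn fun i => hc _]
    exact hc1
  · intro hp
    -- The supports must cover all vertices, so the zero coordinates go to the negative part.
    obtain ⟨m, Tp, hTp, hSp, c, hc, hpc⟩ := exists_isSupportTilting k hQ {x | 0 < p x} (p ⊔ 0)
      (fun x => le_sup_right) (fun x hx => sup_eq_right.2 (not_lt.1 hx))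
    obtain ⟨l, Tm, hTm, hSm, d, hd, hpd⟩ := exists_isSupportTilting k hQ {x | 0 < p x}ᶜ (-p ⊔ 0)
      (fun x => le_sup_right) (fun x hx => sup_eq_right.2 (by
        have : 0 < p x := Set.notMem_compl_iff.1 hx
        simp only [Pi.neg_apply, Pi.zero_apply]
        linarith))
    refine ⟨m, l, Tp, Tm, hTp, hTm, by rw [hSp, hSm]; exact isCompl_compl, ?_⟩
    rw [Set.mem_ofPred_eq, hpc, hpd, hTp.seqGauge_eq hQ hn hc, hTm.seqGauge_eq hQ hn hd] at hp
    rw [← Set.Sum.elim_range, mem_convexHull_insert_zero_range]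
    refine ⟨Sum.elim c d, ?_, ?_, ?_⟩
    · rintro (i | i)
      · exact hc i
      · exact hd i
    · rw [Fintype.sum_sum_type]
      exact hp
    · rw [Fintype.sum_sum_type]
      simp only [Sum.elim_inl, Sum.elim_inr, smul_neg, Finset.sum_neg_distrib, ← sub_eq_add_neg]
      rw [← hpc, ← hpd]
      exact sup_sub_neg_sup p

theorem PClus_eq (k : Type u) [Field k] (hQ : IsLinear Q o pos) [Fintype V] [DecidableEq V]
    (hn : ∀ x, pos x < n) :
    PClus k Q = {p | seqGauge n (toSeq pos (p ⊔ 0)) + ∑ x, (-p ⊔ 0) x ≤ 1} := by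
  classical
  have hsum : ∀ (S : Set V) (c : V → ℝ), (∑ j : ↥Sᶜ, c j • -Pi.single (j : V) (1 : ℝ)) =
      -fun x => if x ∈ S then 0 else c x := by
    intro S c
    funext x
    simp only [Finset.sum_apply, Pi.smul_apply, Pi.neg_apply, smul_eq_mul, mul_neg,
      Finset.sum_neg_distrib, neg_inj]
    by_cases hx : x ∈ S
    · rw [if_pos hx, Finset.sum_eq_zero]
      intro j _
      rw [Pi.single_eq_of_ne (by rintro rfl; exact j.2 hx), mul_zero]
    · rw [if_neg hx, Finset.sum_eq_single (⟨x, hx⟩ : ↥Sᶜ)]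
      · simp
      · intro j _ hj
        rw [Pi.single_eq_of_ne fun h => hj (Subtype.ext h.symm), mul_zero]
      · simp
  have hsum' : ∀ (S : Set V) (c : V → ℝ), (∑ x, if x ∈ S then 0 else c x) = ∑ j : ↥Sᶜ, c j := by
    intro S c
    have h0 : ∀ x, (if x ∈ S then 0 else c x) = if x ∈ Sᶜ then c x else 0 := fun x => by
      by_cases hx : x ∈ S <;> simp [hx]
    simp only [h0]
    rw [← Finset.sum_filter]
    exact Finset.sum_subtype _ (by simp) _
  ext p
  constructor
  · rintro ⟨m, T, hT, hp⟩
    rw [Set.image_eq_range, ← Set.Sum.elim_range, mem_convexHull_insert_zero_range] at hp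
    obtain ⟨c, hc, hc1, hp⟩ := hp
    rw [Fintype.sum_sum_type] at hc1 hp
    simp only [Sum.elim_inl, Sum.elim_inr] at hp
    -- The coefficients of the `-e_j` are extended by zero to all vertices, so that their
    -- combination is minus a vector on `V`.
    set c' : V → ℝ := fun x => if hx : x ∈ (supp T)ᶜ then c (Sum.inr ⟨x, hx⟩) else 0 with hc'
    have hcc : ∀ j : ↥(supp T)ᶜ, c (Sum.inr j) = c' j := fun j => by
      rw [hc']
      simp only
      rw [dif_pos j.2]
    simp only [hcc] at hc1 hp
    rw [hsum, ← sub_eq_add_neg] at hp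
    obtain ⟨h1, h2⟩ := posPart_eq_of_sub hp (sum_smul_dimVec_nonneg fun i => hc _)
      (fun x => by
        split_ifs with h
        · exact le_rfl
        · rw [hc']
          simp only
          split_ifs
          · exact hc _
          · exact le_rfl) fun x => by
        by_cases hx : x ∈ supp T
        · exact Or.inr (if_pos hx)
        · exact Or.inl (sum_smul_dimVec_eq_zero hx _)
    rw [Set.mem_ofPred_eq, h1, h2, hT.seqGauge_eq hQ hn fun i => hc _, hsum']
    exact hc1
  · intro hp
    obtain ⟨m, T, hT, hS, c, hc, hpc⟩ := exists_isSupportTilting k hQ {x | 0 < p x} (p ⊔ 0)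
      (fun x => le_sup_right) (fun x hx => sup_eq_right.2 (not_lt.1 hx))
    have h0 : (fun x => if x ∈ supp T then 0 else (-p ⊔ 0) x) = -p ⊔ 0 := by
      funext x
      rw [hS]
      split_ifs with hx
      · symm
        refine sup_eq_right.2 ?_
        have : 0 < p x := hx
        simp only [Pi.neg_apply, Pi.zero_apply]
        linarith
      · rfl
    refine ⟨m, T, hT, ?_⟩
    rw [Set.mem_ofPred_eq, hpc, hT.seqGauge_eq hQ hn hc, ← h0, hsum'] at hp
    rw [Set.image_eq_range, ← Set.Sum.elim_range, mem_convexHull_insert_zero_range]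
    refine ⟨Sum.elim c fun j => (-p ⊔ 0) j, ?_, ?_, ?_⟩
    · rintro (i | i)
      · exact hc i
      · exact le_sup_right
    · rw [Fintype.sum_sum_type]
      exact hp
    · rw [Fintype.sum_sum_type]
      simp only [Sum.elim_inl, Sum.elim_inr]
      rw [hsum, h0, ← hpc, ← sub_eq_add_neg]
      exact sup_sub_neg_sup p

end QuiverRep

/-! ### Volumes as exponential integrals -/

theorem lintegral_exp_neg_Ioi (a : ℝ) :
    ∫⁻ t in Set.Ioi a, ENNReal.ofReal (Real.exp (-t)) = ENNReal.ofReal (Real.exp (-a)) := by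
  rw [← ofReal_integral_eq_lintegral_ofReal (integrableOn_exp_neg_Ioi a)
    (Filter.Eventually.of_forall fun _ => (Real.exp_pos _).le), integral_exp_neg_Ioi]

theorem lintegral_exp_neg_Ici_zero :
    ∫⁻ t in Set.Ici (0 : ℝ), ENNReal.ofReal (Real.exp (-t)) = 1 := by
  rw [setLIntegral_congr Ioi_ae_eq_Ici.symm, lintegral_exp_neg_Ioi]
  simp

theorem lintegral_pow_mul_exp_neg (n : ℕ) :
    ∫⁻ t in Set.Ioi (0 : ℝ), ENNReal.ofReal (t ^ n) * ENNReal.ofReal (Real.exp (-t)) =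
      (n.factorial : ℝ≥0∞) := by
  have h1 := Real.GammaIntegral_convergent (s := n + 1) (by positivity)
  have h2 := Real.Gamma_eq_integral (s := n + 1) (by positivity)
  rw [Real.Gamma_nat_eq_factorial] at h2
  rw [← ENNReal.ofReal_natCast, h2, ofReal_integral_eq_lintegral_ofReal h1]
  · refine setLIntegral_congr_fun measurableSet_Ioi fun t ht => ?_
    have ht' : (0 : ℝ) < t := ht
    rw [← ENNReal.ofReal_mul (by positivity), mul_comm, add_sub_cancel_right, Real.rpow_natCast]
  · refine (ae_restrict_iff' measurableSet_Ioi).2 (Filter.Eventually.of_forall fun t ht => ?_)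
    have ht' : (0 : ℝ) < t := ht
    simp only [Pi.zero_apply]
    positivity

/-- The integral volume of the sublevel set of a positively homogeneous function on a cone is an
exponential integral. -/
theorem factorial_mul_volume_eq_lintegral {ι : Type*} [Fintype ι] {h : (ι → ℝ) → ℝ}
    (hm : Measurable h) {S : Set (ι → ℝ)} (hSm : MeasurableSet S)
    (hS : ∀ t : ℝ, 0 < t → ∀ x ∈ S, t • x ∈ S) (hh : ∀ t : ℝ, 0 < t → ∀ x, h (t • x) = t * h x)
    (h0 : ∀ x ∈ S, 0 ≤ h x) :
    ((Fintype.card ι).factorial : ℝ≥0∞) * volume {x | x ∈ S ∧ h x ≤ 1} =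
      ∫⁻ x in S, ENNReal.ofReal (Real.exp (-h x)) := by
  set F : ℝ → ℝ≥0∞ := fun t => ENNReal.ofReal (Real.exp (-t)) with hF
  have hFm : Measurable F := by fun_prop
  -- Layer cake: `exp (-h x)` is the integral of `exp (-t)` over `t ≥ h x`. After exchanging the
  -- integrals, the sublevel set at `t` contributes `t ^ n` times the one at `1`, and the Gamma
  -- integral yields the factorial.
  have h1 : ∀ x ∈ S, ENNReal.ofReal (Real.exp (-h x)) = ∫⁻ t in Set.Ioi 0, (Set.Ici (h x)).indicator F t := by
    intro x hx
    rw [lintegral_indicator measurableSet_Ici, Measure.restrict_restrict measurableSet_Ici,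
      ← lintegral_exp_neg_Ioi (h x)]
    refine setLIntegral_congr ?_
    rcases (h0 x hx).eq_or_lt with h2 | h2
    · rw [← h2, Set.inter_eq_right.2 Set.Ioi_subset_Ici_self]
      exact Filter.EventuallyEq.refl _ _
    · have hI : Set.Ici (h x) ∩ Set.Ioi 0 = Set.Ici (h x) :=
        Set.inter_eq_left.2 fun t ht => h2.trans_le ht
      rw [hI]
      exact Ioi_ae_eq_Ici
  have hvol : ∀ t : ℝ, 0 < t → volume {x | x ∈ S ∧ h x ≤ t} =
      ENNReal.ofReal (t ^ Fintype.card ι) * volume {x | x ∈ S ∧ h x ≤ 1} := by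
    intro t ht
    have h2 := Measure.addHaar_smul (volume : Measure (ι → ℝ)) t {x | x ∈ S ∧ h x ≤ 1}
    rw [Module.finrank_fintype_fun_eq_card, abs_of_pos (by positivity)] at h2
    rw [← h2]
    congr 1
    ext x
    rw [Set.mem_smul_set_iff_inv_smul_mem₀ ht.ne']
    have h3 : h (t⁻¹ • x) = t⁻¹ * h x := hh _ (inv_pos.2 ht) x
    constructor
    · rintro ⟨hx, hx'⟩
      refine ⟨hS _ (inv_pos.2 ht) x hx, ?_⟩
      rw [h3, inv_mul_le_iff₀ ht, mul_one]
      exact hx'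
    · rintro ⟨hx, hx'⟩
      rw [h3, inv_mul_le_iff₀ ht, mul_one] at hx'
      refine ⟨?_, hx'⟩
      have := hS t ht _ hx
      rwa [smul_inv_smul₀ ht.ne'] at this
  have hmeas : MeasurableSet {p : (ι → ℝ) × ℝ | h p.1 ≤ p.2} :=
    measurableSet_le (hm.comp measurable_fst) measurable_snd
  rw [setLIntegral_congr_fun hSm h1, lintegral_lintegral_swap]
  · rw [← lintegral_pow_mul_exp_neg, mul_comm, ← lintegral_const_mul _ (by fun_prop)]
    refine setLIntegral_congr_fun measurableSet_Ioi fun t ht => ?_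
    have h2 : ∀ x, (Set.Ici (h x)).indicator F t = {x | h x ≤ t}.indicator (fun _ => F t) x := by
      intro x
      by_cases hx : h x ≤ t
      · rw [Set.indicator_of_mem (by exact hx), Set.indicator_of_mem (by exact hx)]
      · rw [Set.indicator_of_notMem (by exact hx), Set.indicator_of_notMem (by exact hx)]
    have hmt : MeasurableSet {x | h x ≤ t} := measurableSet_le hm measurable_const
    rw [lintegral_congr h2, lintegral_indicator hmt, setLIntegral_const,
      Measure.restrict_apply hmt]
    have h3 : {x | h x ≤ t} ∩ S = {x | x ∈ S ∧ h x ≤ t} := by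
      ext x
      exact and_comm
    rw [h3, hvol t ht]
    ring
  · have h2 : (Function.uncurry fun x t => (Set.Ici (h x)).indicator F t) =
        {p : (ι → ℝ) × ℝ | h p.1 ≤ p.2}.indicator fun p => F p.2 := by
      funext ⟨x, t⟩
      by_cases hx : h x ≤ t
      · rw [Set.indicator_of_mem (by exact hx), Function.uncurry_apply_pair,
          Set.indicator_of_mem (by exact hx)]
      · rw [Set.indicator_of_notMem (by exact hx), Function.uncurry_apply_pair,
          Set.indicator_of_notMem (by exact hx)]
    rw [h2]
    exact ((hFm.comp measurable_snd).indicator hmeas).aemeasurable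

/-! ### Splitting integrals over orthants -/

section orthant

variable {ι : Type*}

open Classical in
/-- Extension by zero. -/
def extendZero (J : Set ι) (u : J → ℝ) : ι → ℝ := fun x => if h : x ∈ J then u ⟨x, h⟩ else 0

theorem measurable_extendZero (J : Set ι) : Measurable (extendZero J) := by
  refine measurable_pi_lambda _ fun x => ?_
  unfold extendZero
  split_ifs with h
  · exact measurable_pi_apply _
  · exact measurable_const

theorem measurable_mul_sup_zero {H₁ H₂ : (ι → ℝ) → ℝ≥0∞} (h₁ : Measurable H₁)
    (h₂ : Measurable H₂) : Measurable fun x : ι → ℝ => H₁ (x ⊔ 0) * H₂ (-x ⊔ 0) := by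
  refine (h₁.comp ?_).mul (h₂.comp ?_)
  · exact measurable_pi_lambda _ fun i => (measurable_pi_apply i).sup_const 0
  · exact measurable_pi_lambda _ fun i => (measurable_pi_apply i).neg.sup_const 0

variable [Fintype ι]

open Classical in
/-- The integral of `H` over the nonnegative orthant of the coordinate subspace `ℝ^J`. -/
def orthantIntegral (H : (ι → ℝ) → ℝ≥0∞) (J : Set ι) : ℝ≥0∞ :=
  ∫⁻ u in Set.Ici (0 : J → ℝ), H (extendZero J u)

/-- Lebesgue measure on the nonnegative reals, or the point mass at zero. -/
def halfLineMeasure (c : Bool) : Measure ℝ :=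
  bif c then volume.restrict (Set.Ici 0) else Measure.dirac 0

instance (c : Bool) : SigmaFinite (halfLineMeasure c) := by
  cases c
  · exact inferInstanceAs (SigmaFinite (Measure.dirac (0 : ℝ)))
  · exact inferInstanceAs (SigmaFinite (volume.restrict (Set.Ici (0 : ℝ))))

theorem pi_halfLineMeasure_true (κ : Type*) [Fintype κ] :
    Measure.pi (fun _ : κ => halfLineMeasure true) = volume.restrict (Set.Ici 0) := by
  rw [← Set.pi_univ_Ici, volume_pi, Measure.restrict_pi_pi]
  rfl

theorem Ici_ae_eq_Ioi_pi (κ : Type*) [Fintype κ] :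
    (Set.univ.pi fun _ : κ => Set.Ioi (0 : ℝ)) =ᵐ[volume] Set.Ici (0 : κ → ℝ) :=
  Measure.univ_pi_Ioi_ae_eq_Ici

theorem pi_dirac_zero (κ : Type*) [Fintype κ] :
    Measure.pi (fun _ : κ => Measure.dirac (0 : ℝ)) = Measure.dirac 0 := by
  refine Measure.pi_eq fun s hs => ?_
  rw [Measure.dirac_apply' _ (MeasurableSet.univ_pi hs)]
  simp only [fun i => Measure.dirac_apply' (0 : ℝ) (hs i)]
  by_cases h : ∀ i, (0 : ℝ) ∈ s i
  · rw [Set.indicator_of_mem (by simpa using h)]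
    simp [h]
  · rw [Set.indicator_of_notMem (by simpa using h)]
    push Not at h
    obtain ⟨i, hi⟩ := h
    rw [Finset.prod_eq_zero (Finset.mem_univ i) (by simp [hi])]

-- The point masses at zero outside `J` write an integral over a face of the orthant as an integral
-- over the whole space. All faces thereby become product measures on `ℝ^ι`.
open Classical in
theorem lintegral_pi_halfLineMeasure {H : (ι → ℝ) → ℝ≥0∞} (hH : Measurable H) (J : Set ι) :
    ∫⁻ x, H x ∂(Measure.pi fun i => halfLineMeasure (decide (i ∈ J))) = orthantIntegral H J := by
  have h1 := measurePreserving_piEquivPiSubtypeProd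
    (fun i : ι => halfLineMeasure (decide (i ∈ J))) (fun i => i ∈ J)
  rw [← h1.symm.lintegral_comp hH]
  have h2 : (Measure.pi fun i : {x // x ∈ J} => halfLineMeasure (decide ((i : ι) ∈ J))) =
      volume.restrict (Set.Ici 0) := by
    rw [← pi_halfLineMeasure_true]
    congr
    funext i
    simp [i.2]
  have h3 : (Measure.pi fun i : {x // ¬ x ∈ J} => halfLineMeasure (decide ((i : ι) ∈ J))) =
      Measure.dirac 0 := by
    rw [← pi_dirac_zero]
    congr
    funext i
    simp [i.2, halfLineMeasure]
  rw [h2, h3, lintegral_prod _ (by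
    exact (hH.comp (MeasurableEquiv.measurable _)).aemeasurable), orthantIntegral]
  refine lintegral_congr fun u => ?_
  rw [lintegral_dirac' _ (by
    exact hH.comp ((MeasurableEquiv.measurable _).comp measurable_prodMk_left))]
  congr 1

open Classical in
theorem orthantIntegral_neg {H : (ι → ℝ) → ℝ≥0∞} (J : Set ι) :
    ∫⁻ v : J → ℝ, (Set.univ.pi fun _ => Set.Iio (0 : ℝ)).indicator
      (fun v => H (extendZero J (-v))) v = orthantIntegral H J := by
  rw [orthantIntegral, ← lintegral_neg_eq_self, ← setLIntegral_congr (Ici_ae_eq_Ioi_pi J),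
    ← lintegral_indicator (MeasurableSet.univ_pi fun _ => measurableSet_Ioi)]
  refine lintegral_congr fun v => ?_
  by_cases hv : v ∈ Set.univ.pi fun _ : J => Set.Ioi (0 : ℝ)
  · rw [Set.indicator_of_mem hv, Set.indicator_of_mem, neg_neg]
    intro i hi
    have := hv i hi
    simpa using this
  · rw [Set.indicator_of_notMem hv, Set.indicator_of_notMem]
    intro hv'
    refine hv fun i hi => ?_
    have := hv' i hi
    simpa using this

/-- The orthant of the points which are nonnegative exactly at the coordinates in `J`. -/
def orthant (J : Set ι) : Set (ι → ℝ) := {x | ∀ i, (i ∈ J ↔ 0 ≤ x i)}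

theorem measurableSet_orthant (J : Set ι) : MeasurableSet (orthant J) := by
  simp only [orthant, Set.ofPred_forall]
  refine MeasurableSet.iInter fun i => ?_
  have h0 : MeasurableSet {x : ι → ℝ | 0 ≤ x i} :=
    measurableSet_le measurable_const (measurable_pi_apply i)
  by_cases hi : i ∈ J
  · simp only [hi, true_iff]
    exact h0
  · simp only [hi, false_iff]
    exact h0.compl

-- On this orthant the positive part depends only on the coordinates in `J` and the negative part
-- only on the others, so the integral factors after a change of sign in the latter.
open Classical in
theorem lintegral_indicator_orthant {H₁ H₂ : (ι → ℝ) → ℝ≥0∞} (h₁ : Measurable H₁)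
    (h₂ : Measurable H₂) (J : Set ι) :
    ∫⁻ x, (orthant J).indicator (fun x => H₁ (x ⊔ 0) * H₂ (-x ⊔ 0)) x =
      orthantIntegral H₁ J * orthantIntegral H₂ {x | ¬ x ∈ J} := by
  have hR := measurableSet_orthant J
  have hm := measurable_mul_sup_zero h₁ h₂
  have hp := volume_preserving_piEquivPiSubtypeProd (fun _ : ι => ℝ) (fun i => i ∈ J)
  rw [← hp.symm.lintegral_comp (hm.indicator hR), ← orthantIntegral_neg {x | ¬ x ∈ J}, orthantIntegral,
    ← lintegral_indicator measurableSet_Ici]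
  set A : ({i // i ∈ J} → ℝ) → ℝ≥0∞ :=
    (Set.Ici 0).indicator fun u => H₁ (extendZero J u) with hA
  set B : ({i // ¬ i ∈ J} → ℝ) → ℝ≥0∞ :=
    (Set.univ.pi fun _ => Set.Iio (0 : ℝ)).indicator
      fun v => H₂ (extendZero {x | ¬ x ∈ J} (-v)) with hB
  have hAm : Measurable A :=
    (h₁.comp (measurable_extendZero _)).indicator measurableSet_Ici
  have hBm : Measurable B :=
    (h₂.comp ((measurable_extendZero _).comp measurable_neg)).indicator
      (MeasurableSet.univ_pi fun _ => measurableSet_Iio)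
  have hAB := lintegral_prod_mul (μ := volume) (ν := volume) hAm.aemeasurable hBm.aemeasurable
  refine Eq.trans ?_ (hAB.trans ?_)
  swap
  · congr 1
    congr!
  rw [← Measure.volume_eq_prod]
  · refine lintegral_congr fun p => ?_
    obtain ⟨u, v⟩ := p
    change _ = A u * B v
    set x := (MeasurableEquiv.piEquivPiSubtypeProd (fun _ : ι => ℝ)
      (fun i => i ∈ J)).symm (u, v) with hx
    have hxu : ∀ (i : ι) (hi : i ∈ J), x i = u ⟨i, hi⟩ := fun i hi => dif_pos hi
    have hxv : ∀ (i : ι) (hi : ¬ i ∈ J), x i = v ⟨i, hi⟩ := fun i hi => dif_neg hi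
    by_cases hxR : x ∈ orthant J
    · have hu : u ∈ Set.Ici (0 : J → ℝ) := fun i => by
        rw [← hxu i.1 i.2]
        exact (hxR i).1 i.2
      have hv : v ∈ Set.univ.pi fun _ : {x // ¬ x ∈ J} => Set.Iio (0 : ℝ) := fun i _ => by
        have := mt (hxR i).2 i.2
        rw [hxv i.1 i.2] at this
        exact not_le.1 this
      rw [Set.indicator_of_mem hxR, hA, Set.indicator_of_mem hu, hB, Set.indicator_of_mem hv]
      refine congrArg₂ _ (congrArg H₁ ?_) (congrArg H₂ ?_)
      · funext i
        simp only [Pi.sup_apply, Pi.zero_apply, extendZero]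
        split_ifs with hi
        · rw [hxu i hi]
          exact sup_eq_left.2 (hu _)
        · rw [hxv i hi]
          exact sup_eq_right.2 (le_of_lt (hv ⟨i, hi⟩ trivial))
      · funext i
        simp only [Pi.sup_apply, Pi.zero_apply, extendZero, Pi.neg_apply]
        split_ifs with hi
        · rw [hxv i hi]
          exact sup_eq_left.2 (neg_nonneg.2 (le_of_lt (hv ⟨i, hi⟩ trivial)))
        · rw [hxu i (not_not.1 hi)]
          exact sup_eq_right.2 (neg_nonpos.2 (hu _))
    · rw [Set.indicator_of_notMem hxR]
      by_cases hu : u ∈ Set.Ici (0 : J → ℝ)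
      · have hv : v ∉ Set.univ.pi fun _ : {x // ¬ x ∈ J} => Set.Iio (0 : ℝ) := by
          intro hv
          refine hxR fun i => ⟨fun hi => ?_, fun hi => ?_⟩
          · rw [hxu i hi]
            exact hu _
          · by_contra hi'
            rw [hxv i hi'] at hi
            exact (hv ⟨i, hi'⟩ trivial).not_ge hi
        refine Eq.symm (mul_eq_zero_of_right _ ?_)
        exact Set.indicator_of_notMem hv _
      · rw [hA, Set.indicator_of_notMem hu, zero_mul]

open Classical in
theorem lintegral_sup_zero_mul {H₁ H₂ : (ι → ℝ) → ℝ≥0∞} (h₁ : Measurable H₁)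
    (h₂ : Measurable H₂) :
    ∫⁻ x, H₁ (x ⊔ 0) * H₂ (-x ⊔ 0) =
      ∑ I : Finset ι, orthantIntegral H₁ (I : Set ι) *
        orthantIntegral H₂ ((Iᶜ : Finset ι) : Set ι) := by
  have hsum : ∀ x, H₁ (x ⊔ 0) * H₂ (-x ⊔ 0) = ∑ I : Finset ι,
      (orthant (I : Set ι)).indicator (fun x => H₁ (x ⊔ 0) * H₂ (-x ⊔ 0)) x := by
    intro x
    -- Zero counts as nonnegative, so the orthants are disjoint and cover the space exactly.
    rw [Finset.sum_eq_single (Finset.univ.filter fun i => 0 ≤ x i)]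
    · rw [Set.indicator_of_mem]
      intro i
      simp
    · intro I _ hI
      rw [Set.indicator_of_notMem]
      intro hx
      refine hI ?_
      ext i
      simpa using hx i
    · simp
  rw [lintegral_congr hsum, lintegral_finsetSum _ fun I _ =>
    (measurable_mul_sup_zero h₁ h₂).indicator (measurableSet_orthant _)]
  refine Finset.sum_congr rfl fun I _ => ?_
  have hc : ((Iᶜ : Finset ι) : Set ι) = {x | ¬ x ∈ (I : Set ι)} := by
    ext x
    simp
  rw [lintegral_indicator_orthant h₁ h₂, hc]

theorem lintegral_exp_neg_sum (κ : Type*) [Fintype κ] :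
    ∫⁻ u in Set.Ici (0 : κ → ℝ), ENNReal.ofReal (Real.exp (-∑ j, u j)) = 1 := by
  have hint : Integrable (fun t : ℝ => Real.exp (-t)) (volume.restrict (Set.Ici 0)) :=
    (integrableOn_Ici_iff_integrableOn_Ioi (by simp)).2 (integrableOn_exp_neg_Ioi 0)
  have h1 : ∀ u : κ → ℝ, Real.exp (-∑ j, u j) = ∏ j, Real.exp (-u j) := fun u => by
    rw [← Finset.sum_neg_distrib, Real.exp_sum]
  simp only [h1]
  rw [← pi_halfLineMeasure_true, ← ofReal_integral_eq_lintegral_ofReal]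
  · rw [integral_fintype_prod_eq_prod (fun _ t => Real.exp (-t))]
    simp only [halfLineMeasure, cond_true]
    rw [integral_Ici_eq_integral_Ioi, integral_exp_neg_Ioi]
    simp
  · exact Integrable.fintype_prod (f := fun _ t => Real.exp (-t)) fun _ => hint
  · exact Filter.Eventually.of_forall fun u => Finset.prod_nonneg fun _ _ => (Real.exp_pos _).le

theorem sum_extendZero (J : Set ι) [Fintype J] (u : J → ℝ) :
    ∑ i, extendZero J u i = ∑ j, u j := by
  classical
  have h0 : ∀ i ∈ Finset.univ, extendZero J u i ≠ 0 → i ∈ J := fun i _ hi => by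
    by_contra h
    exact hi (dif_neg h)
  rw [← Finset.sum_filter_of_ne h0, Finset.sum_subtype (p := fun i => i ∈ J) _ (by simp)]
  exact Finset.sum_congr rfl fun j _ => dif_pos j.2

open Classical in
theorem orthantIntegral_exp_neg_sum (J : Set ι) :
    orthantIntegral (fun x => ENNReal.ofReal (Real.exp (-∑ i, x i))) J = 1 := by
  rw [orthantIntegral, ← lintegral_exp_neg_sum J]
  simp only [sum_extendZero]

end orthant

/-! ### Transfer operators: integrating out one coordinate at a time -/

section transfer

/-- The kernel of the transfer operator which computes the exponential integral of the gauge. -/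
def kern (b y : ℝ) : ℝ≥0∞ := ENNReal.ofReal (Real.exp (-(b - min b y)))

theorem measurable_kern : Measurable (Function.uncurry kern) := by
  unfold Function.uncurry kern
  fun_prop

theorem kern_zero_left {y : ℝ} (hy : 0 ≤ y) : kern 0 y = 1 := by
  simp [kern, hy]

/-- Iterated application of the transfer operators of the measures `halfLineMeasure c`. -/
def transfer : List Bool → ℝ → ℝ≥0∞
  | [], b => kern b 0
  | c :: l, b => ∫⁻ y, kern b y * transfer l y ∂halfLineMeasure c

theorem measurable_transfer (l : List Bool) : Measurable (transfer l) := by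
  induction l with
  | nil => exact measurable_kern.comp measurable_prodMk_right
  | cons c l ih =>
    exact Measurable.lintegral_prod_right' (f := fun p : ℝ × ℝ => kern p.1 p.2 * transfer l p.2)
      (measurable_kern.mul (ih.comp measurable_snd))

theorem measurable_kern_mul (l : List Bool) (b : ℝ) :
    Measurable fun y => kern b y * transfer l y :=
  (measurable_kern.comp measurable_prodMk_left).mul (measurable_transfer l)

theorem transfer_false_cons (l : List Bool) (b : ℝ) :
    transfer (false :: l) b = kern b 0 * transfer l 0 := by
  change ∫⁻ y, kern b y * transfer l y ∂Measure.dirac 0 = _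
  rw [lintegral_dirac' _ (measurable_kern_mul l b)]

/-- A coordinate fixed at zero ends the first piece in the same way as the end of the line does, and
the second piece starts afresh from the value zero. -/
theorem transfer_append_false (l l' : List Bool) (b : ℝ) :
    transfer (l ++ false :: l') b = transfer l b * transfer l' 0 := by
  induction l generalizing b with
  | nil => exact transfer_false_cons l' b
  | cons c l ih =>
    simp only [List.cons_append, transfer, ih, ← mul_assoc]
    rw [lintegral_mul_const _ (measurable_kern_mul l b)]

theorem measurable_toSeq {V : Type v} {pos : V → ℕ} (i : ℕ) :
    Measurable fun x : V → ℝ => toSeq pos x i := by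
  classical
  unfold toSeq Function.extend
  by_cases h : ∃ a, pos a = i
  · simp only [h, dif_pos]
    exact measurable_pi_apply _
  · simp only [h, dif_neg, not_false_eq_true]
    exact measurable_const

theorem measurable_seqGauge_toSeq {V : Type v} {pos : V → ℕ} (n : ℕ) :
    Measurable fun x : V → ℝ => seqGauge n (toSeq pos x) := by
  unfold seqGauge
  exact Finset.measurable_sum _ fun i _ =>
    (measurable_toSeq i).sub ((measurable_toSeq i).min (measurable_toSeq (i + 1)))

theorem seqGauge_succ (n : ℕ) (D : ℕ → ℝ) :
    seqGauge (n + 1) D = (D 0 - min (D 0) (D 1)) + seqGauge n fun i => D (i + 1) := by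
  rw [seqGauge, Finset.sum_range_succ', add_comm]
  rfl

/-- The sequence of the coordinates of a vector, continued by zeros. -/
abbrev finSeq {n : ℕ} (x : Fin n → ℝ) : ℕ → ℝ := toSeq (fun i : Fin n => (i : ℕ)) x

theorem finSeq_of_lt {n : ℕ} (x : Fin n → ℝ) {i : ℕ} (h : i < n) : finSeq x i = x ⟨i, h⟩ :=
  toSeq_pos Fin.val_injective x ⟨i, h⟩

theorem finSeq_of_le {n : ℕ} (x : Fin n → ℝ) {i : ℕ} (h : n ≤ i) : finSeq x i = 0 :=
  toSeq_of_notMem x (by rintro ⟨j, rfl⟩; exact h.not_gt j.2)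

theorem finSeq_cons_succ {n : ℕ} (y : ℝ) (x : Fin n → ℝ) (i : ℕ) :
    finSeq (Fin.cons y x : Fin (n + 1) → ℝ) (i + 1) = finSeq x i := by
  by_cases h : i < n
  · rw [finSeq_of_lt _ (Nat.succ_lt_succ h), finSeq_of_lt _ h]
    exact Fin.cons_succ (α := fun _ => ℝ) y x ⟨i, h⟩
  · rw [finSeq_of_le _ (by omega), finSeq_of_le _ (by omega)]

/-- The exponential of minus the gauge. -/
def expGauge (n : ℕ) (x : Fin n → ℝ) : ℝ≥0∞ := ENNReal.ofReal (Real.exp (-seqGauge n (finSeq x)))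

theorem measurable_expGauge (n : ℕ) : Measurable (expGauge n) :=
  ENNReal.measurable_ofReal.comp (Real.measurable_exp.comp (measurable_seqGauge_toSeq n).neg)

theorem measurable_kern_mul_expGauge (n : ℕ) (b : ℝ) :
    Measurable fun x : Fin n → ℝ => kern b (finSeq x 0) * expGauge n x :=
  (measurable_kern.comp (measurable_const.prodMk (measurable_toSeq 0))).mul
    (measurable_expGauge n)

theorem kern_mul_expGauge {n : ℕ} (b : ℝ) (y : ℝ) (x : Fin n → ℝ) :
    kern b (finSeq (Fin.cons y x : Fin (n + 1) → ℝ) 0) * expGauge (n + 1) (Fin.cons y x) =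
      kern b y * (kern y (finSeq x 0) * expGauge n x) := by
  have h0 : finSeq (Fin.cons y x : Fin (n + 1) → ℝ) 0 = y := by
    rw [finSeq_of_lt _ (Nat.succ_pos n)]
    rfl
  have h1 : expGauge (n + 1) (Fin.cons y x) = kern y (finSeq x 0) * expGauge n x := by
    rw [expGauge, seqGauge_succ, h0, kern, expGauge, ← ENNReal.ofReal_mul (Real.exp_pos _).le,
      ← Real.exp_add, ← neg_add]
    simp only [finSeq_cons_succ]
  rw [h0, h1]

theorem transfer_ofFn {n : ℕ} (s : Fin n → Bool) (b : ℝ) :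
    transfer (List.ofFn s) b =
      ∫⁻ x, kern b (finSeq x 0) * expGauge n x ∂Measure.pi fun i => halfLineMeasure (s i) := by
  induction n generalizing b with
  | zero =>
    rw [List.ofFn_zero, Measure.pi_of_empty, lintegral_dirac, transfer, finSeq_of_le _ le_rfl]
    simp [expGauge, seqGauge]
  | succ n ih =>
    have hm := measurable_kern_mul_expGauge (n + 1) b
    have hp := measurePreserving_piFinSuccAbove (fun i => halfLineMeasure (s i)) 0
    have hm' := hm.comp (MeasurableEquiv.measurable
      (MeasurableEquiv.piFinSuccAbove (fun _ : Fin (n + 1) => ℝ) 0).symm)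
    unfold Function.comp at hm'
    rw [List.ofFn_succ, transfer, ← hp.symm.lintegral_comp hm, lintegral_prod _
      hm'.aemeasurable]
    refine lintegral_congr fun y => ?_
    rw [ih, ← lintegral_const_mul _ (measurable_kern_mul_expGauge n y)]
    refine lintegral_congr fun x => ?_
    rw [← kern_mul_expGauge]
    have : (MeasurableEquiv.piFinSuccAbove (fun _ : Fin (n + 1) => ℝ) 0).symm (y, x) =
        Fin.cons y x := by
      exact Fin.insertNth_zero' (β := ℝ) y x
    rw [this]

theorem ae_halfLineMeasure_nonneg (c : Bool) : ∀ᵐ y ∂halfLineMeasure c, 0 ≤ y := by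
  cases c
  · change ∀ᵐ y ∂Measure.dirac 0, 0 ≤ y
    rw [ae_dirac_iff measurableSet_Ici]
  · exact ae_restrict_mem measurableSet_Ici

/-- The initial value `0` is followed by a nonnegative coordinate, so the additional kernel factor
is `1`. -/
theorem lintegral_expGauge_eq_transfer {n : ℕ} (s : Fin n → Bool) :
    ∫⁻ x, expGauge n x ∂Measure.pi (fun i => halfLineMeasure (s i)) =
      transfer (List.ofFn s) 0 := by
  rw [transfer_ofFn]
  refine lintegral_congr_ae ?_
  have h0 : ∀ᵐ x ∂Measure.pi (fun i => halfLineMeasure (s i)), 0 ≤ finSeq x 0 := by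
    cases n with
    | zero => exact Filter.Eventually.of_forall fun x => (finSeq_of_le x le_rfl).ge
    | succ n =>
      have h1 := (Measure.tendsto_eval_ae_ae (μ := fun i => halfLineMeasure (s i)) (i := 0)).eventually
        (ae_halfLineMeasure_nonneg (s 0))
      filter_upwards [h1] with x hx
      rw [finSeq_of_lt _ (Nat.succ_pos n)]
      exact hx
  filter_upwards [h0] with x hx
  rw [kern_zero_left hx, one_mul]

/-- The sum of the transfer operators over all words of a given length. -/
theorem sum_transfer_ofFn_succ (n : ℕ) (b : ℝ) :
    ∑ s : Fin (n + 1) → Bool, transfer (List.ofFn s) b =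
      ∫⁻ y, kern b y * ∑ s : Fin n → Bool, transfer (List.ofFn s) y ∂halfLineMeasure true +
        kern b 0 * ∑ s : Fin n → Bool, transfer (List.ofFn s) 0 := by
  rw [← (Fin.consEquiv fun _ : Fin (n + 1) => Bool).sum_comp, Fintype.sum_prod_type,
    Fintype.sum_bool]
  change ∑ s : Fin n → Bool, transfer (List.ofFn (Fin.cons true s : Fin (n + 1) → Bool)) b +
    ∑ s : Fin n → Bool, transfer (List.ofFn (Fin.cons false s : Fin (n + 1) → Bool)) b = _
  simp only [List.ofFn_cons, transfer_false_cons, Finset.mul_sum]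
  rw [lintegral_finsetSum _ fun s _ => measurable_kern_mul _ _]
  rfl

/-- The words are sorted by the position `i` of their first `false`; what follows it is an arbitrary
word of length `n - 1 - i`, and the word without `false` stands alone. -/
theorem sum_transfer_ofFn (n : ℕ) (b : ℝ) :
    ∑ s : Fin n → Bool, transfer (List.ofFn s) b = transfer (List.replicate n true) b +
      ∑ i ∈ Finset.range n, transfer (List.replicate i true) b *
        ∑ s : Fin (n - 1 - i) → Bool, transfer (List.ofFn s) 0 := by
  induction n generalizing b with
  | zero => simp
  | succ n ih =>
    rw [sum_transfer_ofFn_succ, Finset.sum_range_succ', ← add_assoc]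
    congr 1
    simp only [ih, mul_add, Finset.mul_sum, ← mul_assoc]
    rw [lintegral_add_left (measurable_kern_mul _ _), lintegral_finsetSum _ fun i _ =>
      Finset.measurable_sum _ fun s _ => (measurable_kern_mul _ _).mul_const _]
    congr 1
    refine Finset.sum_congr rfl fun i _ => ?_
    simp only [← Finset.mul_sum]
    rw [lintegral_mul_const _ (measurable_kern_mul _ _), show n + 1 - 1 - (i + 1) = n - 1 - i by omega]
    rfl

end transfer

/-! ### Integrating out the least coordinate -/

section argmin

variable {n : ℕ}

/-- The vectors with nonnegative entries whose first least entry is the one at `i`. -/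
def argminSet (i : Fin (n + 1)) : Set (Fin (n + 1) → ℝ) :=
  {x | 0 ≤ x i ∧ ∀ j, (j < i → x i < x j) ∧ x i ≤ x j}

theorem measurableSet_argminSet (i : Fin (n + 1)) : MeasurableSet (argminSet i) := by
  have h1 : ∀ j, Measurable fun x : Fin (n + 1) → ℝ => x j := fun j => measurable_pi_apply j
  have h2 : argminSet i = {x | 0 ≤ x i} ∩ ⋂ j, {x | (j < i → x i < x j) ∧ x i ≤ x j} := by
    ext x
    simp [argminSet]
  rw [h2]
  refine (measurableSet_le measurable_const (h1 i)).inter ?_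
  refine MeasurableSet.iInter fun j => ?_
  by_cases hj : j < i
  · simp only [hj, true_imp_iff]
    exact (measurableSet_lt (h1 i) (h1 j)).inter (measurableSet_le (h1 i) (h1 j))
  · simp only [hj, false_imp_iff, true_and]
    exact measurableSet_le (h1 i) (h1 j)

theorem sum_indicator_argminSet (E : (Fin (n + 1) → ℝ) → ℝ≥0∞) (x : Fin (n + 1) → ℝ) :
    (Set.Ici 0).indicator E x = ∑ i, (argminSet i).indicator E x := by
  classical
  by_cases hx : x ∈ Set.Ici (0 : Fin (n + 1) → ℝ)
  · obtain ⟨m, -, hm⟩ := Finset.exists_min_image Finset.univ x ⟨0, Finset.mem_univ _⟩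
    set F := Finset.univ.filter fun i => x i = x m with hF
    have hne : F.Nonempty := ⟨m, by simp [hF]⟩
    have hi : x (F.min' hne) = x m := (Finset.mem_filter.1 (F.min'_mem hne)).2
    have hmem : x ∈ argminSet (F.min' hne) := by
      refine ⟨hx _, fun j => ⟨fun hj => ?_, hi ▸ hm j (Finset.mem_univ _)⟩⟩
      refine lt_of_le_of_ne (hi ▸ hm j (Finset.mem_univ _)) fun h => ?_
      exact (F.min'_le j (Finset.mem_filter.2 ⟨Finset.mem_univ _, h.symm.trans hi⟩)).not_gt hj
    rw [Set.indicator_of_mem hx, Finset.sum_eq_single (F.min' hne), Set.indicator_of_mem hmem]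
    · intro j _ hj
      rw [Set.indicator_of_notMem]
      intro hx'
      rcases lt_or_gt_of_ne hj with h | h
      · exact ((hmem.2 j).1 h).not_ge (hx'.2 _).2
      · exact ((hx'.2 _).1 h).not_ge (hmem.2 j).2
    · simp
  · rw [Set.indicator_of_notMem hx, Finset.sum_eq_zero]
    intro i _
    rw [Set.indicator_of_notMem]
    intro hx'
    exact hx fun j => hx'.1.trans (hx'.2 j).2

/-- The orthant is cut according to the place of the first least entry. Subtracting this entry `m`
moves the vector to a face and costs a factor `exp (-m)`, whose integral over `m ≥ 0` is one. -/
theorem lintegral_Ici_eq_sum_insertNth {E : (Fin (n + 1) → ℝ) → ℝ≥0∞} (hE : Measurable E)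
    (hshift : ∀ (m : ℝ) (x : Fin (n + 1) → ℝ), 0 ≤ m → 0 ≤ x →
      E (fun j => x j + m) = ENNReal.ofReal (Real.exp (-m)) * E x) :
    ∫⁻ x in Set.Ici 0, E x =
      ∑ i : Fin (n + 1), ∫⁻ z in Set.Ici (0 : Fin n → ℝ), E (i.insertNth 0 z) := by
  rw [← lintegral_indicator measurableSet_Ici, lintegral_congr (sum_indicator_argminSet E),
    lintegral_finsetSum _ fun i _ => hE.indicator (measurableSet_argminSet i)]
  refine Finset.sum_congr rfl fun i _ => ?_
  have hp := volume_preserving_piFinSuccAbove (fun _ : Fin (n + 1) => ℝ) i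
  have hEi := hE.indicator (measurableSet_argminSet i)
  have hEi' := hEi.comp (MeasurableEquiv.measurable
    (MeasurableEquiv.piFinSuccAbove (fun _ : Fin (n + 1) => ℝ) i).symm)
  unfold Function.comp at hEi'
  set B : Set (Fin n → ℝ) := {z | ∀ j, (i.succAbove j < i → 0 < z j) ∧ 0 ≤ z j} with hB
  -- The strict inequalities come from breaking ties and only remove a null set.
  have hBae : B =ᵐ[volume] Set.Ici 0 := by
    filter_upwards [Filter.eventuallyEq_set.1 (Ici_ae_eq_Ioi_pi (Fin n))] with z hz
    refine propext ⟨fun h j => (h j).2, fun h j => ?_⟩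
    exact ⟨fun _ => hz.2 h j trivial, h j⟩
  have hBm : MeasurableSet B := by
    simp only [hB, Set.ofPred_forall]
    refine MeasurableSet.iInter fun j => ?_
    by_cases hj : i.succAbove j < i
    · simp only [hj, true_imp_iff]
      exact (measurableSet_lt measurable_const (measurable_pi_apply j)).inter
        (measurableSet_le measurable_const (measurable_pi_apply j))
    · simp only [hj, false_imp_iff, true_and]
      exact measurableSet_le measurable_const (measurable_pi_apply j)
  have hins : Measurable fun z : Fin n → ℝ => E (i.insertNth 0 z) :=
    hE.comp ((MeasurableEquiv.measurable (MeasurableEquiv.piFinSuccAbove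
      (fun _ : Fin (n + 1) => ℝ) i).symm).comp measurable_prodMk_left)
  have hkey : ∀ m (z : Fin n → ℝ), (argminSet i).indicator E (i.insertNth m (z + fun _ => m)) =
      (Set.Ici 0).indicator (fun m => ENNReal.ofReal (Real.exp (-m))) m *
        B.indicator (fun z => E (i.insertNth 0 z)) z := by
    intro m z
    have h1 : (i.insertNth m (z + fun _ => m) : Fin (n + 1) → ℝ) ∈ argminSet i ↔
        m ∈ Set.Ici (0 : ℝ) ∧ z ∈ B := by
      simp only [argminSet, Set.mem_ofPred_eq, Fin.insertNth_apply_same, Set.mem_Ici, hB,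
        Fin.forall_iff_succAbove i, Fin.insertNth_apply_succAbove, Pi.add_apply]
      simp
    by_cases hm : m ∈ Set.Ici (0 : ℝ)
    · by_cases hz : z ∈ B
      · rw [Set.indicator_of_mem (h1.2 ⟨hm, hz⟩), Set.indicator_of_mem hm,
          Set.indicator_of_mem hz, ← hshift m _ hm]
        · congr 1
          funext j
          refine Fin.succAboveCases i ?_ (fun j => ?_) j
          · simp
          · simp
        · intro j
          refine Fin.succAboveCases i ?_ (fun j => ?_) j
          · simp
          · simpa using (hz j).2
      · rw [Set.indicator_of_notMem fun h => hz (h1.1 h).2, Set.indicator_of_notMem hz, mul_zero]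
    · rw [Set.indicator_of_notMem fun h => hm (h1.1 h).1, Set.indicator_of_notMem hm, zero_mul]
  rw [← hp.symm.lintegral_comp hEi, Measure.volume_eq_prod, lintegral_prod _
    hEi'.aemeasurable]
  have hinner : ∀ m : ℝ, ∫⁻ z : Fin n → ℝ, (argminSet i).indicator E
      ((MeasurableEquiv.piFinSuccAbove (fun _ : Fin (n + 1) => ℝ) i).symm (m, z)) =
      (Set.Ici 0).indicator (fun m => ENNReal.ofReal (Real.exp (-m))) m *
        ∫⁻ z in Set.Ici 0, E (i.insertNth 0 z) := by
    intro m
    -- For fixed `m` the other coordinates are translated by `m`, so that they are measured from the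
    -- least one.
    rw [← lintegral_add_right_eq_self _ (fun _ => m), ← setLIntegral_congr hBae,
      ← lintegral_indicator hBm, ← lintegral_const_mul _ (hins.indicator hBm)]
    exact lintegral_congr fun z => hkey m z
  rw [lintegral_congr hinner, lintegral_mul_const _
    ((by fun_prop : Measurable fun m => ENNReal.ofReal (Real.exp (-m))).indicator
      measurableSet_Ici), lintegral_indicator measurableSet_Ici, lintegral_exp_neg_Ici_zero,
    one_mul]

theorem lintegral_insertNth_zero {E : (Fin (n + 1) → ℝ) → ℝ≥0∞} (hE : Measurable E)
    (i : Fin (n + 1)) :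
    ∫⁻ z in Set.Ici (0 : Fin n → ℝ), E (i.insertNth 0 z) =
      ∫⁻ x, E x ∂Measure.pi fun j => halfLineMeasure (decide (j ≠ i)) := by
  have hp := measurePreserving_piFinSuccAbove
    (fun j : Fin (n + 1) => halfLineMeasure (decide (j ≠ i))) i
  have hE' := hE.comp (MeasurableEquiv.measurable
    (MeasurableEquiv.piFinSuccAbove (fun _ : Fin (n + 1) => ℝ) i).symm)
  unfold Function.comp at hE'
  rw [← hp.symm.lintegral_comp hE, lintegral_prod _ hE'.aemeasurable]
  have h1 : halfLineMeasure (decide (i ≠ i)) = Measure.dirac 0 := by simp [halfLineMeasure]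
  have h2 : (Measure.pi fun j => halfLineMeasure (decide (i.succAbove j ≠ i))) =
      volume.restrict (Set.Ici 0) := by
    rw [← pi_halfLineMeasure_true]
    congr
    funext j
    simp
  have hm : Measurable fun y : ℝ => ∫⁻ z : Fin n → ℝ in Set.Ici 0,
      E ((MeasurableEquiv.piFinSuccAbove (fun _ : Fin (n + 1) => ℝ) i).symm (y, z)) :=
    Measurable.lintegral_prod_right' (f := fun p => E ((MeasurableEquiv.piFinSuccAbove
      (fun _ : Fin (n + 1) => ℝ) i).symm p)) hE'
  rw [h1, h2, lintegral_dirac' _ hm]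
  rfl

/-- The inner drops do not change; only the last one, from the final coordinate down to zero, grows
by `m`. -/
theorem expGauge_add {m : ℝ} {x : Fin (n + 1) → ℝ} (hm : 0 ≤ m) (hx : 0 ≤ x) :
    expGauge (n + 1) (fun j => x j + m) =
      ENNReal.ofReal (Real.exp (-m)) * expGauge (n + 1) x := by
  have h1 : seqGauge (n + 1) (finSeq fun j => x j + m) = m + seqGauge (n + 1) (finSeq x) := by
    have h2 : ∀ i < n + 1, finSeq (fun j => x j + m) i = finSeq x i + m := fun i hi => by
      rw [finSeq_of_lt _ hi, finSeq_of_lt _ hi]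
    have h3 : 0 ≤ finSeq x n := by
      rw [finSeq_of_lt _ (Nat.lt_succ_self n)]
      exact hx _
    rw [seqGauge, seqGauge, Finset.sum_range_succ, Finset.sum_range_succ,
      finSeq_of_le (fun j => x j + m) le_rfl, finSeq_of_le x le_rfl, h2 n (Nat.lt_succ_self n),
      min_eq_right (add_nonneg h3 hm), min_eq_right h3, Finset.sum_congr rfl fun i hi => by
        have hi := Finset.mem_range.1 hi
        rw [h2 i (by omega), h2 (i + 1) (by omega), min_add_add_right, add_sub_add_right_eq_sub]]
    ring
  rw [expGauge, h1, neg_add, Real.exp_add, ENNReal.ofReal_mul (Real.exp_pos _).le, expGauge]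

end argmin

/-! ### The Catalan recursion -/

theorem ofFn_true (n : ℕ) : List.ofFn (fun _ : Fin n => true) = List.replicate n true :=
  List.ofFn_const n true

theorem ofFn_ne (n : ℕ) (i : Fin (n + 1)) :
    List.ofFn (fun j : Fin (n + 1) => decide (j ≠ i)) =
      List.replicate i true ++ false :: List.replicate (n - i) true := by
  refine List.ext_getElem ?_ fun j h1 h2 => ?_
  · simp only [List.length_ofFn, List.length_append, List.length_replicate, List.length_cons]
    omega
  · rw [List.getElem_ofFn, List.getElem_append]
    simp only [List.length_replicate]
    split_ifs with h
    · simp only [List.getElem_replicate, decide_eq_true_eq]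
      exact fun h3 => h.ne (congrArg Fin.val h3)
    · rcases eq_or_lt_of_le (not_lt.1 h) with h3 | h3
      · have : (⟨j, by simpa using h1⟩ : Fin (n + 1)) = i := Fin.ext h3.symm
        simp [this, h3]
      · obtain ⟨t, ht⟩ : ∃ t, j - i = t + 1 := ⟨j - i - 1, by omega⟩
        simp only [ht, List.getElem_cons_succ, List.getElem_replicate, decide_eq_true_eq]
        exact fun h4 => h3.ne' (congrArg Fin.val h4)

/-- The exponential integrals of the gauge satisfy the recursion of the Catalan numbers. -/
theorem transfer_replicate_succ_eq_sum (n : ℕ) :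
    transfer (List.replicate (n + 1) true) 0 =
      ∑ i : Fin (n + 1), transfer (List.ofFn fun j : Fin (n + 1) => decide (j ≠ i)) 0 := by
  rw [← ofFn_true, ← lintegral_expGauge_eq_transfer, pi_halfLineMeasure_true,
    lintegral_Ici_eq_sum_insertNth (measurable_expGauge _) fun m x hm hx => expGauge_add hm hx]
  refine Finset.sum_congr rfl fun i _ => ?_
  rw [lintegral_insertNth_zero (measurable_expGauge _), lintegral_expGauge_eq_transfer]

theorem transfer_replicate_succ (n : ℕ) :
    transfer (List.replicate (n + 1) true) 0 = ∑ i ∈ Finset.range (n + 1),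
      transfer (List.replicate i true) 0 * transfer (List.replicate (n - i) true) 0 := by
  rw [transfer_replicate_succ_eq_sum, Finset.sum_range]
  refine Finset.sum_congr rfl fun i _ => ?_
  rw [ofFn_ne, transfer_append_false]

/-- By induction, the tail after the first `false` contributes the integral for one more vertex. The
sum then becomes the Catalan recursion for `n + 1`, with the word without `false` as its last term.
-/
theorem sum_transfer_ofFn_zero (n : ℕ) :
    ∑ s : Fin n → Bool, transfer (List.ofFn s) 0 = transfer (List.replicate (n + 1) true) 0 := by
  induction n using Nat.strong_induction_on with
  | _ n ih =>
    have h0 : transfer (List.replicate 0 true) 0 = 1 := kern_zero_left le_rfl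
    rw [sum_transfer_ofFn, transfer_replicate_succ, Finset.sum_range_succ, add_comm, Nat.sub_self,
      h0, mul_one]
    congr 1
    refine Finset.sum_congr rfl fun i hi => ?_
    have hi := Finset.mem_range.1 hi
    rw [ih _ (by omega), show n - 1 - i + 1 = n - i by omega]

/-! ### Volumes of the polytopes in type `A` -/

theorem seqGauge_nonneg (n : ℕ) (D : ℕ → ℝ) : 0 ≤ seqGauge n D :=
  Finset.sum_nonneg fun _ _ => sub_nonneg.2 (min_le_left _ _)

theorem seqGauge_toSeq_smul {V : Type v} {pos : V → ℕ} (hpos : Function.Injective pos) (n : ℕ)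
    {t : ℝ} (ht : 0 < t) (x : V → ℝ) :
    seqGauge n (toSeq pos (t • x)) = t * seqGauge n (toSeq pos x) := by
  have h : ∀ i, toSeq pos (t • x) i = t * toSeq pos x i := by
    intro i
    by_cases hi : i ∈ Set.range pos
    · obtain ⟨y, rfl⟩ := hi
      simp [toSeq_pos hpos]
    · simp [toSeq_of_notMem _ hi]
  simp only [seqGauge, h, Finset.mul_sum]
  exact Finset.sum_congr rfl fun i _ => by rw [← mul_min_of_nonneg _ _ ht.le, mul_sub]

theorem smul_sup_zero {V : Type v} {t : ℝ} (ht : 0 < t) (x : V → ℝ) :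
    t • x ⊔ 0 = t • (x ⊔ 0) := by
  funext i
  simp only [Pi.sup_apply, Pi.smul_apply, Pi.zero_apply, smul_eq_mul]
  rw [mul_max_of_nonneg _ _ ht.le, mul_zero]

theorem smul_neg_sup_zero {V : Type v} {t : ℝ} (ht : 0 < t) (x : V → ℝ) :
    -(t • x) ⊔ 0 = t • (-x ⊔ 0) := by
  rw [← smul_neg, smul_sup_zero ht]

theorem ofReal_exp_neg_add (a b : ℝ) : ENNReal.ofReal (Real.exp (-(a + b))) =
    ENNReal.ofReal (Real.exp (-a)) * ENNReal.ofReal (Real.exp (-b)) := by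
  rw [neg_add, Real.exp_add, ENNReal.ofReal_mul (Real.exp_pos _).le]

theorem measurable_sup_zero {V : Type v} : Measurable fun x : V → ℝ => x ⊔ 0 :=
  measurable_pi_lambda _ fun i => (measurable_pi_apply i).sup_const 0

theorem measurable_neg_sup_zero {V : Type v} : Measurable fun x : V → ℝ => -x ⊔ 0 :=
  measurable_pi_lambda _ fun i => (measurable_pi_apply i).neg.sup_const 0

section volume

variable (k : Type u) [Field k] {V : Type v} {Q : Quiver.{w} V} {o : ℕ → Bool} {pos : V → ℕ}
  [Fintype V] {n : ℕ}

theorem tPlus_eq_lintegral (hQ : IsLinear Q o pos) (hn : ∀ x, pos x < n) :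
    tPlus k Q = ∫⁻ x in Set.Ici (0 : V → ℝ),
      ENNReal.ofReal (Real.exp (-seqGauge n (toSeq pos x))) := by
  rw [tPlus, integralVolume, QuiverRep.PPlus_eq k hQ hn]
  exact factorial_mul_volume_eq_lintegral (measurable_seqGauge_toSeq n) measurableSet_Ici
    (fun t ht x hx i => mul_nonneg ht.le (hx i))
    (fun t ht x => seqGauge_toSeq_smul hQ.injective n ht x) fun x _ => seqGauge_nonneg _ _

theorem tFull_eq_lintegral (hQ : IsLinear Q o pos) (hn : ∀ x, pos x < n) :
    tFull k Q = ∫⁻ x : V → ℝ, ENNReal.ofReal (Real.exp (-seqGauge n (toSeq pos (x ⊔ 0)))) *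
      ENNReal.ofReal (Real.exp (-seqGauge n (toSeq pos (-x ⊔ 0)))) := by
  rw [tFull, integralVolume, QuiverRep.PFull_eq k hQ hn]
  have h := factorial_mul_volume_eq_lintegral (S := Set.univ)
    (((measurable_seqGauge_toSeq n).comp measurable_sup_zero).add
      ((measurable_seqGauge_toSeq (pos := pos) n).comp measurable_neg_sup_zero))
    MeasurableSet.univ (fun _ _ _ _ => trivial) (fun t ht x => by
      simp only [Pi.add_apply, Function.comp_apply]
      rw [smul_sup_zero ht, smul_neg_sup_zero ht, seqGauge_toSeq_smul hQ.injective n ht,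
        seqGauge_toSeq_smul hQ.injective n ht, mul_add])
    fun x _ => add_nonneg (seqGauge_nonneg _ _) (seqGauge_nonneg _ _)
  simpa only [Set.mem_univ, true_and, Measure.restrict_univ, Pi.add_apply, Function.comp_apply,
    ofReal_exp_neg_add] using h

theorem tClus_eq_lintegral [DecidableEq V] (hQ : IsLinear Q o pos) (hn : ∀ x, pos x < n) :
    tClus k Q = ∫⁻ x : V → ℝ, ENNReal.ofReal (Real.exp (-seqGauge n (toSeq pos (x ⊔ 0)))) *
      ENNReal.ofReal (Real.exp (-∑ i, (-x ⊔ 0) i)) := by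
  rw [tClus, integralVolume, QuiverRep.PClus_eq k hQ hn]
  have hm : Measurable fun x : V → ℝ => ∑ i, (-x ⊔ 0) i :=
    Finset.measurable_sum _ fun i _ => (measurable_pi_apply i).comp measurable_neg_sup_zero
  have h := factorial_mul_volume_eq_lintegral (S := Set.univ)
    (((measurable_seqGauge_toSeq (pos := pos) n).comp measurable_sup_zero).add hm)
    MeasurableSet.univ (fun _ _ _ _ => trivial) (fun t ht x => by
      simp only [Pi.add_apply, Function.comp_apply]
      rw [smul_sup_zero ht, smul_neg_sup_zero ht, seqGauge_toSeq_smul hQ.injective n ht,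
        mul_add, Finset.mul_sum]
      rfl)
    fun x _ => add_nonneg (seqGauge_nonneg _ _) (Finset.sum_nonneg fun i _ => le_sup_right)
  simpa only [Set.mem_univ, true_and, Measure.restrict_univ, Pi.add_apply, Function.comp_apply,
    ofReal_exp_neg_add] using h

end volume

section typeA

variable (k : Type u) [Field k] (n : ℕ) (o : ℕ → Bool)

/-- The right-hand side involves neither `o` nor `k`; this is why the orientations can be chosen
independently for each number of vertices. -/
theorem tPlus_typeA : tPlus k (typeA n o) = transfer (List.replicate n true) 0 := by
  rw [tPlus_eq_lintegral k (isLinear_typeA n o) (n := n) (fun x => x.2), ← ofFn_true,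
    ← lintegral_expGauge_eq_transfer, pi_halfLineMeasure_true]
  rfl

/-- Removed vertices count as zeros in the gauge, so the gauge of the full subquiver is that of the
whole line on a coordinate face. -/
theorem tPlus_fullSubquiver (J : Set (Fin n)) [Fintype J] :
    tPlus k (fullSubquiver (typeA n o) J) = orthantIntegral (expGauge n) J := by
  rw [tPlus_eq_lintegral k ((isLinear_typeA n o).fullSubquiver J) (n := n) (fun x => x.1.2),
    orthantIntegral]
  have h : ∀ x : J → ℝ, ENNReal.ofReal (Real.exp (-seqGauge n
      (toSeq (fun y : J => ((y : Fin n) : ℕ)) x))) = expGauge n (extendZero J x) := by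
    intro x
    rw [expGauge, finSeq, ← toSeq_subtype Fin.val_injective J (extendZero J x) fun i hi =>
      dif_neg hi]
    congr 5
    funext j
    unfold extendZero
    rw [dif_pos j.2]
  simp only [h]
  congr!

open Classical in
theorem tPlus_fullSubquiver_eq_transfer (J : Set (Fin n)) [Fintype J] :
    tPlus k (fullSubquiver (typeA n o) J) = transfer (List.ofFn fun i => decide (i ∈ J)) 0 := by
  rw [tPlus_fullSubquiver, ← lintegral_pi_halfLineMeasure (measurable_expGauge n),
    lintegral_expGauge_eq_transfer]

theorem sum_tPlus_fullSubquiver :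
    ∑ I : Finset (Fin n), tPlus k (fullSubquiver (typeA n o) (I : Set (Fin n))) =
      transfer (List.replicate (n + 1) true) 0 := by
  classical
  rw [← sum_transfer_ofFn_zero]
  refine Fintype.sum_equiv ⟨fun I i => decide (i ∈ I), fun s => Finset.univ.filter fun i => s i,
    fun I => by ext; simp, fun s => by ext; simp⟩ _ _ fun I => ?_
  rw [tPlus_fullSubquiver_eq_transfer]
  simp

theorem tFull_typeA : tFull k (typeA n o) = ∑ I : Finset (Fin n),
    tPlus k (fullSubquiver (typeA n o) (I : Set (Fin n))) *
      tPlus k (fullSubquiver (typeA n o) ((Iᶜ : Finset (Fin n)) : Set (Fin n))) := by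
  rw [tFull_eq_lintegral k (isLinear_typeA n o) (n := n) (fun x => x.2)]
  refine (lintegral_sup_zero_mul (measurable_expGauge n) (measurable_expGauge n)).trans ?_
  refine Finset.sum_congr rfl fun I _ => ?_
  rw [tPlus_fullSubquiver, tPlus_fullSubquiver]
  congr!

theorem tClus_typeA : tClus k (typeA n o) =
    ∑ I : Finset (Fin n), tPlus k (fullSubquiver (typeA n o) (I : Set (Fin n))) := by
  rw [tClus_eq_lintegral k (isLinear_typeA n o) (n := n) (fun x => x.2)]
  refine (lintegral_sup_zero_mul (measurable_expGauge n)
    (H₂ := fun x => ENNReal.ofReal (Real.exp (-∑ i, x i))) (by fun_prop)).trans ?_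
  refine Finset.sum_congr rfl fun I _ => ?_
  rw [tPlus_fullSubquiver, orthantIntegral_exp_neg_sum, mul_one]

end typeA

end

theorem mainTheorem4 (k : Type*) [Field k] (o : ℕ → ℕ → Bool) (n : ℕ) (hn : 1 ≤ n) :
    (tFull k (typeA n (o n)) =
      ∑ I : Finset (Fin n),
        tPlus k (fullSubquiver (typeA n (o n)) (I : Set (Fin n))) *
          tPlus k (fullSubquiver (typeA n (o n)) ((Iᶜ : Finset (Fin n)) : Set (Fin n)))) ∧
    (tClus k (typeA n (o n)) =
        ∑ I : Finset (Fin n),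
          tPlus k (fullSubquiver (typeA n (o n)) ((Iᶜ : Finset (Fin n)) : Set (Fin n))) ∧
      tClus k (typeA n (o n)) =
        ∑ i ∈ Finset.range (n + 1),
          tPlus k (typeA i (o i)) * tPlus k (typeA (n - i) (o (n - i)))) ∧
    (tPlus k (typeA n (o n)) =
        ∑ i : Fin n,
          tPlus k (fullSubquiver (typeA n (o n)) ((({i} : Finset (Fin n))ᶜ : Finset (Fin n)) :
            Set (Fin n))) ∧
      tPlus k (typeA n (o n)) =
        ∑ i ∈ Finset.range n,
          tPlus k (typeA i (o i)) * tPlus k (typeA (n - 1 - i) (o (n - 1 - i)))) := by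
  refine ⟨tFull_typeA k n (o n), ⟨?_, ?_⟩, ?_⟩
  · rw [tClus_typeA]
    -- The orthant formula attaches `t⁺` to the set of nonnegative coordinates; complementation
    -- reindexes the sum.
    exact (Equiv.sum_comp (Function.Involutive.toPerm compl
      (compl_involutive (α := Finset (Fin n)))) fun I : Finset (Fin n) =>
        tPlus k (fullSubquiver (typeA n (o n)) (I : Set (Fin n)))).symm
  · rw [tClus_typeA, sum_tPlus_fullSubquiver, transfer_replicate_succ]
    simp only [tPlus_typeA]
  · obtain ⟨n, rfl⟩ : ∃ m, n = m + 1 := ⟨n - 1, by omega⟩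
    simp only [tPlus_typeA, Nat.add_sub_cancel]
    refine ⟨?_, transfer_replicate_succ n⟩
    rw [transfer_replicate_succ_eq_sum]
    refine Finset.sum_congr rfl fun i _ => ?_
    rw [tPlus_fullSubquiver_eq_transfer]
    congr 3
    funext j
    simp
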